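/- Let $k\in\{3,4,5\}$. There is a randomized algorithm in the CONGEST model that detects $2k$-cycles in $O(n^{1-1/k})$ rounds. In detail: the communication network is the input graph $G$ itself, an arbitrary simple undirected graph on $n$ nodes; every node knows $n$, its own identifier and the identifiers of its neighbours, where identifiers are distinct natural numbers below $n^{c}$ for a fixed constant $c$; the nodes have private independent randomness and unbounded local computation, and in each synchronous round every node may send a (possibly different) message of $O(\log n)$ bits to each of its neighbours. There is a constant $C$, depending only on $k$, such that for every $c$ there is such an algorithm in which, on every $n$-node graph $G$ and for every assignment of identifiers, all nodes stop after at most $C\,n^{1-1/k}$ rounds, each accepting or rejecting, and * if $G$ contains a cycle of length $2k$, then with probability at least $2/3$ at least one node rejects; * if $G$ contains no cycle of length $2k$, then with probability $1$ all nodes accept. -/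

import Mathlib

namespace Congest

/-- A message of a network with bandwidth `b`: a string of `b` bits. -/
abbrev Message (b : ℕ) : Type := Fin b → Bool

/-- The program that all nodes of a synchronous message-passing network with bandwidth `b` run.
Local computation is unbounded. Every node holds a private random seed, uniformly distributed on a
finite set and independent of the seeds of the other nodes.

* `start i N r` is the initial state of the node with identifier `i` whose neighbours have the set
  `N` of identifiers and whose seed is `r`.
* `send s j` is what a node in state `s` sends in the current round to its neighbour with
  identifier `j` (`none`: it sends nothing).
* `receive s inbox` is the state at the end of the round; `inbox j` is what arrived from
  the neighbour with identifier `j`.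
* `rejects s` says whether a node that stops in state `s` rejects (otherwise it accepts). -/
structure NodeProgram (b : ℕ) where
  Seed : Type
  [seedFintype : Fintype Seed]
  [seedNonempty : Nonempty Seed]
  State : Type
  start : ℕ → Set ℕ → Seed → State
  send : State → ℕ → Option (Message b)
  receive : State → (ℕ → Option (Message b)) → State
  rejects : State → Bool

attribute [instance] NodeProgram.seedFintype NodeProgram.seedNonempty

open Classical in
/-- What node `v` receives, by the identifier of the sender, when the nodes are in the states
`s`: messages travel along the edges of `G` only. -/
noncomputable def inbox {b : ℕ} (P : NodeProgram b) {V : Type*} (G : SimpleGraph V) (ident : V → ℕ)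
    (s : V → P.State) (v : V) : ℕ → Option (Message b) :=
  Function.extend ident (fun u => if G.Adj u v then P.send (s u) (ident v) else none)
    (fun _ => none)

/-- The states of the nodes after `t` rounds, when `G` is the communication graph, `ident` gives
the identifiers and `seed` the random seeds. -/
noncomputable def stateAfter {b : ℕ} (P : NodeProgram b) {V : Type*} (G : SimpleGraph V)
    (ident : V → ℕ) (seed : V → P.Seed) : ℕ → V → P.State
  | 0 => fun v => P.start (ident v) (ident '' G.neighborSet v) (seed v)
  | t + 1 => fun v =>
      P.receive (stateAfter P G ident seed t v) (inbox P G ident (stateAfter P G ident seed t) v)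

/-- A randomized CONGEST algorithm. On networks with `n` nodes (all nodes know `n`) a message
has `bandwidthFactor * ⌊log₂ n⌋ = O(log n)` bits, all nodes run `program n`, and
they all stop after `rounds n` rounds. -/
structure Algorithm where
  bandwidthFactor : ℕ
  rounds : ℕ → ℕ
  program : (n : ℕ) → NodeProgram (bandwidthFactor * Nat.log 2 n)

/-- The possible outcomes of the private coin flips of all nodes. -/
abbrev Algorithm.Seeds (A : Algorithm) (V : Type*) [Fintype V] : Type _ :=
  V → (A.program (Fintype.card V)).Seed

/-- The random seeds for which some node of the network rejects. -/
def Algorithm.rejectEvent (A : Algorithm) {V : Type*} [Fintype V] (G : SimpleGraph V)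
    (ident : V → ℕ) : Set (A.Seeds V) :=
  {seed | ∃ v, (A.program (Fintype.card V)).rejects
    (stateAfter (A.program (Fintype.card V)) G ident seed (A.rounds (Fintype.card V)) v) = true}

/-- The probability that some node of the network rejects; the seeds of the nodes are independent
and uniform. -/
noncomputable def Algorithm.rejectProb (A : Algorithm) {V : Type*} [Fintype V] [DecidableEq V]
    (G : SimpleGraph V) (ident : V → ℕ) : ENNReal :=
  (PMF.uniformOfFintype (A.Seeds V)).toOuterMeasure (A.rejectEvent G ident)

/-- `G` contains a (simple) cycle of length `l`. -/
def HasCycleOfLength {V : Type*} (G : SimpleGraph V) (l : ℕ) : Prop :=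
  ∃ (v : V) (p : G.Walk v v), p.IsCycle ∧ p.length = l

end Congest

/-! ### Paths and cycles -/

namespace Congest
variable {V : Type*} {G : SimpleGraph V}

open SimpleGraph

/-! Let d = ⌊n^(1/k)⌋. Each node is selected with probability 1/d, so the set S of selected nodes
usually has size O(n^(1-1/k)); a node is light if its degree is at most a certain D = O(d). In
constantly many repetitions the nodes take random colours below 2k. Sources of colour 0 are then
propagated along the colours 1, 2, …, k and along 2k-1, …, k. A node reached by one source along
both sides closes a genuine 2k-cycle, so there are no false rejections. A node that has heard of
more than τ = O(n^(1-1/k)) sources stays silent, which bounds the congestion.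

Three searches suffice. If the cycle is light, searching among light nodes only meets at most
D^(k-1) sources per node before the last level. If some 2k-cycle meets S, the search from S finds it
with at most |S| sources. Otherwise no 2k-cycle meets S, and the cycle has a heavy vertex, which
very likely has at least 2k² selected neighbours; the third search starts from all unselected nodes
of this kind and avoids S.

The third search is the crux: if a node at level 1 ≤ j < k heard of more than k|S| sources, these
would be the leaves of a tree disjoint from S with many edges from the leaves to S, and
`exists_cycleThrough_of_dense` would produce a 2k-cycle through S. It joins an alternating path
between S and the leaves to two branches of the tree; the length of the alternating path compensates
for the height at which the branches meet.

Failures are bounded by 1/9 each: too many selected nodes, a heavy vertex with too few selected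
neighbours, and no repetition that colours the cycle correctly. The argument needs only k ≥ 2, and
the exponent c affects only the message length. -/

theorem exists_path_of_adj_succ (f : ℕ → V) (n : ℕ) (h : ∀ i < n, G.Adj (f i) (f (i + 1)))
    (hf : ∀ i ≤ n, ∀ j ≤ n, f i = f j → i = j) :
    ∃ p : G.Walk (f 0) (f n), p.IsPath ∧ p.length = n ∧ ∀ x, x ∈ p.support ↔ ∃ i ≤ n, f i = x := by
  induction n with
  | zero => exact ⟨.nil, by simp, rfl, fun x => by simp [eq_comm]⟩
  | succ n ih =>
    obtain ⟨p, hpath, hp, hs⟩ := ih (fun i hi => h i (by omega))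
      fun i hi j hj => hf i (by omega) j (by omega)
    refine ⟨p.concat (h n (by omega)), hpath.concat ?_ _, by simp [hp], fun x => ?_⟩
    · rw [hs]
      rintro ⟨i, hi, hx⟩
      have := hf i (by omega) (n + 1) le_rfl hx
      omega
    simp only [Walk.support_concat, List.mem_append, hs, List.mem_singleton]
    constructor
    · rintro (⟨i, hi, rfl⟩ | rfl)
      · exact ⟨i, by omega, rfl⟩
      · exact ⟨n + 1, le_rfl, rfl⟩
    · rintro ⟨i, hi, rfl⟩
      rcases Nat.lt_or_ge i (n + 1) with h' | h'
      · exact .inl ⟨i, by omega, rfl⟩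
      · exact .inr (by congr 1; omega)

theorem isPath_append {a b c : V} {p : G.Walk a b} {q : G.Walk b c} (hp : p.IsPath)
    (hq : q.IsPath) (h : ∀ x ∈ p.support, x ∈ q.support → x = b) : (p.append q).IsPath := by
  rw [Walk.isPath_def, Walk.support_append, List.nodup_append]
  have hq' := hq.support_nodup
  rw [← Walk.cons_tail_support, List.nodup_cons] at hq'
  refine ⟨hp.support_nodup, hq'.2, fun x hx y hy hxy => ?_⟩
  subst hxy
  have := h x hx (List.mem_of_mem_tail hy)
  subst this
  exact hq'.1 hy

/-- Two paths with the same ends that share no other vertex form a cycle. -/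
theorem exists_isCycle_of_paths {a b : V} (p q : G.Walk a b) (hp : p.IsPath) (hq : q.IsPath)
    (h : ∀ x ∈ p.support, x ∈ q.support → x = a ∨ x = b) (hab : a ≠ b)
    (hlen : 3 ≤ p.length + q.length) :
    ∃ c : G.Walk a a, c.IsCycle ∧ c.length = p.length + q.length ∧
      ∀ x ∈ q.support, x ∈ c.support := by
  cases q with
  | nil => exact absurd rfl hab
  | @cons _ a' _ h' q' =>
    rw [Walk.cons_isPath_iff] at hq
    have hpath : (q'.append p.reverse).IsPath := by
      refine isPath_append hq.1 hp.reverse fun x hx hx' => ?_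
      rw [Walk.support_reverse, List.mem_reverse] at hx'
      rcases h x hx' (by simp [hx]) with rfl | rfl
      · exact absurd hx hq.2
      · rfl
    refine ⟨Walk.cons h' (q'.append p.reverse), ?_, ?_, ?_⟩
    · rw [Walk.cons_isCycle_iff]
      refine ⟨hpath, fun he => ?_⟩
      -- An edge joining the two ends of a path is the whole path, which the length bound excludes.
      rw [Sym2.eq_swap] at he
      have := hpath.length_eq_one_of_mem_edges he
      simp at this hlen
      omega
    · simp; omega
    · intro x hx
      simp at hx ⊢
      tauto

/-- There is a cycle of length `l` through `v`. -/
def CycleThrough (G : SimpleGraph V) (l : ℕ) (v : V) : Prop :=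
  ∃ p : G.Walk v v, p.IsCycle ∧ p.length = l

theorem cycleThrough_of_mem_support [DecidableEq V] {v x : V} {p : G.Walk v v} (hp : p.IsCycle)
    (hx : x ∈ p.support) : CycleThrough G p.length x :=
  ⟨p.rotate x hx, hp.rotate hx, by simp⟩

/-- A cycle, listed in order. -/
structure IsCycleSeq (G : SimpleGraph V) (l : ℕ) (z : ℕ → V) : Prop where
  adj : ∀ i < l, G.Adj (z i) (z (i + 1))
  closed : z l = z 0
  inj : ∀ i < l, ∀ j < l, z i = z j → i = j

theorem CycleThrough.exists_seq {l : ℕ} {v : V} (h : CycleThrough G l v) :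
    ∃ z : ℕ → V, IsCycleSeq G l z ∧ z 0 = v := by
  obtain ⟨p, hp, rfl⟩ := h
  refine ⟨p.getVert, ⟨fun i hi => p.adj_getVert_succ hi, by simp, fun i hi j hj hij => ?_⟩, by simp⟩
  exact hp.getVert_injOn' (by simp; omega) (by simp; omega) hij

theorem IsCycleSeq.cycleThrough [DecidableEq V] {l : ℕ} {z : ℕ → V} (h : IsCycleSeq G l z)
    (hl : 3 ≤ l) (i : ℕ) (hi : i < l) : CycleThrough G l (z i) := by
  obtain ⟨p, hp, hlen, hs⟩ := exists_path_of_adj_succ z (l - 1) (fun j hj => h.adj j (by omega))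
    fun i hi j hj => h.inj i (by omega) j (by omega)
  have ha := h.adj (l - 1) (by omega)
  rw [Nat.sub_add_cancel (by omega), h.closed] at ha
  have hc : (Walk.cons ha p).IsCycle := by
    rw [Walk.cons_isCycle_iff]
    refine ⟨hp, fun he => ?_⟩
    rw [Sym2.eq_swap] at he
    have := hp.length_eq_one_of_mem_edges he
    omega
  have hmem : z i ∈ (Walk.cons ha p).support := by
    rw [Walk.support_cons, List.mem_cons, hs]
    exact .inr ⟨i, by omega, rfl⟩
  have := cycleThrough_of_mem_support hc hmem
  rwa [Walk.length_cons, hlen, Nat.sub_add_cancel (by omega)] at this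

theorem HasCycleOfLength.le_card [Fintype V] {l : ℕ} (h : HasCycleOfLength G l) :
    l ≤ Fintype.card V := by
  obtain ⟨v, p, hp⟩ := h
  obtain ⟨z, hz, -⟩ := CycleThrough.exists_seq (v := v) ⟨p, hp⟩
  have : Function.Injective fun i : Fin l => z i :=
    fun i j hij => Fin.ext (hz.inj i i.2 j j.2 hij)
  simpa using Fintype.card_le_of_injective _ this
end Congest

/-! ### Dense pairs and cycles through a small set -/

namespace Congest
open SimpleGraph Finset

section MinDegree
variable {α β : Type*} [DecidableEq α] [DecidableEq β]

/-- A bipartite relation of average degree greater than `2 * K` has a part of minimum degree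
greater than `K`. -/
theorem exists_minDegree_gt (r : α → β → Prop) [∀ a b, Decidable (r a b)] (K : ℕ) (A : Finset α)
    (B : Finset β) (h : K * (#A + #B) < ∑ a ∈ A, #{b ∈ B | r a b}) :
    ∃ A' ⊆ A, ∃ B' ⊆ B, B'.Nonempty ∧ (∀ a ∈ A', K < #{b ∈ B' | r a b}) ∧
      ∀ b ∈ B', K < #{a ∈ A' | r a b} := by
  induction hN : #A + #B generalizing A B with
  | zero =>
    obtain ⟨hA, -⟩ := Nat.add_eq_zero_iff.1 hN
    rw [Finset.card_eq_zero] at hA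
    simp [hA] at h
  | succ N ih =>
    -- Deleting a vertex of degree at most `K` costs at most `K` edges and lowers the required bound
    -- by exactly `K`, so the hypothesis persists.
    by_cases h1 : ∃ a ∈ A, #{b ∈ B | r a b} ≤ K
    · obtain ⟨a, ha, hle⟩ := h1
      have hc := Finset.card_erase_add_one ha
      have hs := Finset.sum_erase_add A (fun a => #{b ∈ B | r a b}) ha
      obtain ⟨A', hA', B', hB', h'⟩ := ih (A.erase a) B (by
        rw [← hc] at h
        have : K * (#(A.erase a) + 1 + #B) = K * (#(A.erase a) + #B) + K := by ring
        omega) (by omega)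
      exact ⟨A', hA'.trans (Finset.erase_subset _ _), B', hB', h'⟩
    by_cases h2 : ∃ b ∈ B, #{a ∈ A | r a b} ≤ K
    · obtain ⟨b, hb, hle⟩ := h2
      have hc := Finset.card_erase_add_one hb
      have hd1 := sum_card_bipartiteAbove_eq_sum_card_bipartiteBelow r (s := A) (t := B)
      have hd2 := sum_card_bipartiteAbove_eq_sum_card_bipartiteBelow r (s := A) (t := B.erase b)
      simp only [bipartiteAbove, bipartiteBelow] at hd1 hd2
      have hs := Finset.sum_erase_add B (fun b => #{a ∈ A | r a b}) hb
      obtain ⟨A', hA', B', hB', h'⟩ := ih A (B.erase b) (by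
        rw [← hc] at h
        have : K * (#A + (#(B.erase b) + 1)) = K * (#A + #(B.erase b)) + K := by ring
        omega) (by omega)
      exact ⟨A', hA', B', hB'.trans (Finset.erase_subset _ _), h'⟩
    push Not at h1 h2
    refine ⟨A, Subset.rfl, B, Subset.rfl, ?_, h1, h2⟩
    rw [Finset.nonempty_iff_ne_empty]
    rintro rfl
    simp at h

end MinDegree

variable {V : Type*} [DecidableEq V] {G : SimpleGraph V}

theorem exists_mem_notMem_support {a b : V} (p : G.Walk a b) (T : Finset V)
    (h : p.length + 1 < #T) : ∃ x ∈ T, x ∉ p.support := by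
  have h1 : #p.support.toFinset < #T :=
    (List.toFinset_card_le _).trans_lt (by rwa [Walk.length_support])
  obtain ⟨x, hx, hx'⟩ := Finset.exists_mem_notMem_of_card_lt_card h1
  exact ⟨x, hx, by simpa using hx'⟩

/-- In a bipartite relation of large minimum degree, alternating paths are found greedily. -/
theorem exists_alternating_path (r : V → V → Prop) [∀ a b, Decidable (r a b)]
    (hr : ∀ a b, r a b → G.Adj a b) {γ : Type*} (g h : V → γ) (hgh : ∀ a b, r a b → g a = h b)
    (K : ℕ) (A B : Finset V) (hA : ∀ a ∈ A, K < #{b ∈ B | r a b})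
    (hB : ∀ b ∈ B, K < #{a ∈ A | r a b}) {b : V} (hb : b ∈ B) (m : ℕ) (hm : 2 * m + 1 ≤ K) :
    ∃ a ∈ A, g a = h b ∧ ∃ q : G.Walk a b, q.IsPath ∧ q.length = 2 * m + 1 ∧
      ∀ x ∈ q.support, x ∈ A ∨ x ∈ B := by
  induction m with
  | zero =>
    obtain ⟨a, ha⟩ := Finset.card_pos.1 ((Nat.zero_le _).trans_lt (hB b hb))
    rw [mem_filter] at ha
    have hab := hr a b ha.2
    refine ⟨a, ha.1, hgh a b ha.2, Walk.cons hab Walk.nil, ?_, by simp, ?_⟩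
    · simp [hab.ne]
    · simp [ha.1, hb]
  | succ m ih =>
    -- Two edges are added at the front; the degrees exceed the number of vertices used so far, so
    -- fresh neighbours exist.
    obtain ⟨a, ha, hgb, q, hq, hlen, hs⟩ := ih (by omega)
    obtain ⟨w, hw, hwq⟩ := exists_mem_notMem_support q _
      (show q.length + 1 < #{b ∈ B | r a b} by have := hA a ha; omega)
    rw [mem_filter] at hw
    have haw := (hr a w hw.2).symm
    obtain ⟨a', ha', haq⟩ := exists_mem_notMem_support (Walk.cons haw q) _
      (show (Walk.cons haw q).length + 1 < #{a ∈ A | r a w} by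
        have := hB w hw.1
        simp only [Walk.length_cons]
        omega)
    rw [mem_filter] at ha'
    refine ⟨a', ha'.1, ?_, Walk.cons (hr _ _ ha'.2) (Walk.cons haw q),
      (hq.cons hwq).cons haq, by simp [hlen]; omega, ?_⟩
    · rw [hgh _ _ ha'.2, ← hgh _ _ hw.2, hgb]
    · intro x hx
      simp only [Walk.support_cons, List.mem_cons] at hx
      rcases hx with rfl | rfl | hx
      · exact .inl ha'.1
      · exact .inr hw.1
      · exact hs x hx

/-- Descending in a tree with the leaf set `N`, where `f i w` is the ancestor of the leaf `w` at
height `i`, one reaches a leaf or a branching at which no child carries almost all of the leaves,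
and leaves only few of the leaves behind. -/
theorem exists_branching (N : Finset V) (f : ℕ → V → V) (j K : ℕ) (v : V)
    (hv : ∀ w ∈ N, f j w = v) :
    ∃ i ≤ j, ∃ y, #N ≤ K * j + #{w ∈ N | f i w = y} ∧
      (i = 0 ∨ ∀ y', K ≤ #{w ∈ N | f i w = y ∧ f (i - 1) w ≠ y'}) := by
  classical
  -- Take the least height reachable when each downward step may lose up to `K` leaves. If some
  -- child missed fewer than `K` leaves, one could step down to it, against minimality.
  let P : ℕ → Prop := fun i => ∃ y, #N ≤ K * (j - i) + #{w ∈ N | f i w = y}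
  have hP : P j := ⟨v, by rw [Finset.filter_true_of_mem hv]; omega⟩
  have hex : ∃ i, P i := ⟨j, hP⟩
  obtain ⟨y, hy⟩ := Nat.find_spec hex
  have hij : Nat.find hex ≤ j := Nat.find_min' hex hP
  have hmin : ∀ m, m < Nat.find hex → ¬ P m := fun m => Nat.find_min hex
  generalize Nat.find hex = i at hy hij hmin
  refine ⟨i, hij, y, hy.trans (by gcongr; omega), ?_⟩
  rcases Nat.eq_zero_or_pos i with h0 | h0
  · exact .inl h0
  refine .inr fun y' => ?_
  by_contra! hlt
  refine hmin (i - 1) (by omega) ⟨y', ?_⟩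
  have h1 : #{w ∈ N | f i w = y} ≤
      #{w ∈ N | f i w = y ∧ f (i - 1) w ≠ y'} + #{w ∈ N | f (i - 1) w = y'} := by
    rw [← Finset.card_union_add_card_inter]
    refine (Finset.card_le_card fun w hw => ?_).trans (Nat.le_add_right _ _)
    simp only [mem_union, mem_filter] at hw ⊢
    tauto
  have h2 : K * (j - (i - 1)) = K * (j - i) + K := by
    rw [show j - (i - 1) = j - i + 1 by omega]; ring
  omega

/-- Let `W` be the set of leaves of a tree in `G` all of whose leaves are at depth `j < k`, where
`π` maps a vertex of the tree to its parent. If every leaf has many neighbours in a set `S`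
outside of the tree that is small compared to `W`, then some cycle of length `2 * k` meets `S`. -/
theorem exists_cycleThrough_of_dense [DecidableRel G.Adj] {k j : ℕ} (hj : 1 ≤ j) (hjk : j < k)
    (W S : Finset V) (π : V → V) (lev : V → ℕ) (v : V)
    (hlev : ∀ w ∈ W, ∀ i ≤ j, lev (π^[i] w) = i) (hS : ∀ w ∈ W, ∀ i ≤ j, π^[i] w ∉ S)
    (hadj : ∀ w ∈ W, ∀ i < j, G.Adj (π^[i] w) (π^[i + 1] w)) (hroot : ∀ w ∈ W, π^[j] w = v)
    (hdeg : ∀ w ∈ W, 2 * k ^ 2 ≤ #{s ∈ S | G.Adj s w}) (hcard : k * #S < #W) :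
    ∃ s ∈ S, CycleThrough G (2 * k) s := by
  -- Each `s` receives a vertex `y s` at height `lv s` above nearly all of its neighbours in `W`; at
  -- most `2 * k * j` of them are lost.
  have hbr := fun s => exists_branching {w ∈ W | G.Adj s w} (fun i => π^[i]) j (2 * k) v
    fun w hw => hroot w (mem_filter.1 hw).1
  choose lv hlv y hN hrich using hbr
  simp only [Finset.filter_filter] at hN hrich
  -- Some positive height carries enough edges. Otherwise summing over all heights gives (k - j)|W|
  -- ≤ (j + 1)|S|, hence |W| ≤ k|S|. Height 0 contributes at most one edge per `s`.
  have hpig : ∃ i ∈ Icc 1 j, 2 * k * (#{s ∈ S | lv s = i} + #W) <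
      ∑ s ∈ S with lv s = i, #{w ∈ W | G.Adj s w ∧ π^[i] w = y s} := by
    by_contra! hle
    have hdc := sum_card_bipartiteAbove_eq_sum_card_bipartiteBelow G.Adj (s := S) (t := W)
    simp only [bipartiteAbove, bipartiteBelow] at hdc
    have h1 : #W * (2 * k ^ 2) ≤ ∑ s ∈ S, #{w ∈ W | G.Adj s w} := by
      rw [hdc, ← smul_eq_mul]
      exact Finset.card_nsmul_le_sum _ _ _ hdeg
    have h2 : ∑ s ∈ S, #{w ∈ W | G.Adj s w} ≤
        #S * (2 * k * j) + ∑ s ∈ S, #{w ∈ W | G.Adj s w ∧ π^[lv s] w = y s} := by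
      rw [← smul_eq_mul, ← Finset.sum_const, ← Finset.sum_add_distrib]
      exact Finset.sum_le_sum fun s _ => hN s
    have h3 : ∑ s ∈ S, #{w ∈ W | G.Adj s w ∧ π^[lv s] w = y s} =
        ∑ i ∈ range (j + 1), ∑ s ∈ S with lv s = i,
          #{w ∈ W | G.Adj s w ∧ π^[i] w = y s} := by
      rw [← Finset.sum_fiberwise_of_maps_to (g := lv) (t := range (j + 1))
        fun s _ => by have := hlv s; simp; omega]
      refine Finset.sum_congr rfl fun i _ => Finset.sum_congr rfl fun s hs => ?_
      rw [(mem_filter.1 hs).2]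
    have h4 : ∀ i ∈ range (j + 1), ∑ s ∈ S with lv s = i, #{w ∈ W | G.Adj s w ∧ π^[i] w = y s} ≤
        2 * k * #{s ∈ S | lv s = i} + if i = 0 then 0 else 2 * k * #W := by
      intro i hi
      rw [mem_range] at hi
      split_ifs with h0
      · subst h0
        have : ∀ s ∈ S.filter (fun s => lv s = 0),
            #{w ∈ W | G.Adj s w ∧ π^[0] w = y s} ≤ 2 * k := by
          intro s _
          refine (Finset.card_le_one.2 ?_).trans (by omega)
          intro a ha b hb
          exact (mem_filter.1 ha).2.2.trans (mem_filter.1 hb).2.2.symm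
        refine (Finset.sum_le_card_nsmul _ _ _ this).trans ?_
        rw [smul_eq_mul, mul_comm]; rfl
      · rw [← mul_add]
        exact hle i (by simp; omega)
    have h5 := Finset.sum_le_sum h4
    rw [Finset.sum_add_distrib, ← Finset.mul_sum, ← Finset.card_eq_sum_card_fiberwise
      fun s _ => by have := hlv s; simp; omega] at h5
    have hite : ∑ i ∈ range (j + 1), (if i = 0 then 0 else 2 * k * #W) = j * (2 * k * #W) := by
      rw [Finset.sum_range_succ']
      simp
    obtain ⟨e, rfl⟩ := Nat.exists_eq_add_of_lt hjk
    have h6 : #W * (2 * (j + e + 1) ^ 2) ≤ #S * (2 * (j + e + 1) * j) +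
        (2 * (j + e + 1) * #S + j * (2 * (j + e + 1) * #W)) := by omega
    have h7 : 2 * (j + e + 1) * (#W * (j + e + 1)) ≤
        2 * (j + e + 1) * (#S * (j + 1) + j * #W) := by linarith
    have h8 := Nat.le_of_mul_le_mul_left h7 (by omega)
    nlinarith [Nat.zero_le (#W * e), Nat.zero_le (#S * e)]
  obtain ⟨i, hi, hlt⟩ := hpig
  rw [mem_Icc] at hi
  obtain ⟨A, hA, B, hB, ⟨b, hb⟩, hdA, hdB⟩ := exists_minDegree_gt
    (fun s w => G.Adj s w ∧ π^[i] w = y s) (2 * k) _ W hlt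
  -- Along the alternating path all vertices share the same branching vertex. Its length 2(k-i-1)+1,
  -- the edge to `w` and two tree paths of length `i` add up to 2k.
  obtain ⟨s, hs, hsb, q, hq, hlen, hsup⟩ := exists_alternating_path
    (fun s w => G.Adj s w ∧ π^[i] w = y s) (fun _ _ h => h.1) y (π^[i]) (fun _ _ h => h.2.symm)
    (2 * k) A B hdA hdB hb (k - i - 1) (by omega)
  have hsS := mem_filter.1 (hA hs)
  have hbW := hB hb
  -- The branching supplies at least `2 * k` neighbours of `s` below `y s` but not below the child
  -- leading to `b`; `q` has fewer than `2 * k` vertices, so one of them is off `q`.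
  have hr := (hrich s).resolve_left (by omega) (π^[i - 1] b)
  rw [hsS.2] at hr
  obtain ⟨w, hw, hwq⟩ := exists_mem_notMem_support q _
    (lt_of_lt_of_le (show q.length + 1 < 2 * k by omega) hr)
  rw [mem_filter] at hw
  obtain ⟨hwW, hsw, hwy, hwb⟩ := hw
  have hpath : ∀ u ∈ W, π^[i] u = y s → ∃ p : G.Walk u (y s), p.IsPath ∧ p.length = i ∧
      ∀ x, x ∈ p.support ↔ ∃ t ≤ i, π^[t] u = x := fun u hu hy => hy ▸
    exists_path_of_adj_succ (fun t => π^[t] u) i (fun t ht => hadj u hu t (by omega))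
      fun t ht t' ht' htt => by
        have := congrArg lev htt
        rwa [hlev u hu t (by omega), hlev u hu t' (by omega)] at this
  obtain ⟨p₀, hp₀, hl₀, hs₀⟩ := hpath w hwW hwy
  obtain ⟨p₁, hp₁, hl₁, hs₁⟩ := hpath b hbW hsb.symm
  -- The path through `s` uses only `S`, which the tree avoids, and leaves, which have level 0. So a
  -- tree path can meet it only in its own leaf.
  have hzero : ∀ u ∈ W, ∀ t ≤ i, ∀ x ∈ (Walk.cons hsw.symm q).support, π^[t] u = x → t = 0 := by
    rintro u hu t ht x hx rfl
    have hmem : π^[t] u ∈ W := by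
      rw [Walk.support_cons, List.mem_cons] at hx
      rcases hx with hx | hx
      · rwa [hx]
      · exact (hsup _ hx).elim
          (fun h => absurd (mem_filter.1 (hA h)).1 (hS u hu t (by omega))) (fun h => hB h)
    rw [← hlev u hu t (by omega)]
    exact hlev _ hmem 0 (by omega)
  have hq₁ : ((Walk.cons hsw.symm q).append p₁).IsPath := by
    refine isPath_append (hq.cons hwq) hp₁ fun x hx hx' => ?_
    obtain ⟨t, ht, htx⟩ := (hs₁ x).1 hx'
    have h0 := hzero b hbW t ht x hx htx
    subst h0
    exact htx.symm
  obtain ⟨c, hc, hcl, hcs⟩ := exists_isCycle_of_paths p₀ _ hp₀ hq₁ (fun x hx hx' => by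
    obtain ⟨t, ht, htx⟩ := (hs₀ x).1 hx
    rw [Walk.mem_support_append_iff] at hx'
    rcases hx' with hx' | hx'
    · have h0 := hzero w hwW t ht x hx' htx
      subst h0
      exact .inl htx.symm
    · obtain ⟨t', ht', htx'⟩ := (hs₁ x).1 hx'
      have htt : t = t' := by
        rw [← hlev w hwW t (by omega), ← hlev b hbW t' (by omega), htx, htx']
      subst htt
      -- If the two tree paths met below height `i`, they would pass through the same child of `y
      -- s`, contrary to the choice of `w`.
      rcases ht.eq_or_lt with rfl | hlt
      · exact .inr (htx.symm.trans hwy)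
      · refine absurd ?_ hwb
        rw [show i - 1 = i - 1 - t + t by omega, Function.iterate_add_apply,
          Function.iterate_add_apply, htx, htx'])
    (fun h => by
      have h1 := hlev w hwW i hi.2
      rw [hwy, ← h] at h1
      have h2 := hlev w hwW 0 (by omega)
      simp only [Function.iterate_zero, id] at h2
      omega)
    (by simp; omega)
  refine ⟨s, hsS.1, ?_⟩
  have := cycleThrough_of_mem_support hc (hcs s (by simp))
  rw [hcl] at this
  convert this using 1
  simp
  omega
end Congest

/-! ### Colour-coded searches with a congestion threshold -/

namespace Congest
open SimpleGraph

section Front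
variable {V : Type*} (G : SimpleGraph V) (H src : V → Prop) (lev : V → ℕ) (τ : ℕ)

/-- The vertices of which `v` has heard after `j` steps of a breadth-first search that is started
at all sources of level `0`, uses only vertices with the property `H`, and proceeds from each level
to the next. A vertex that has heard of more than `τ` sources does not pass anything on. -/
def front : ℕ → V → Set V
  | 0, v => {x | x = v ∧ lev v = 0 ∧ src v}
  | j + 1, v => {x | lev v = j + 1 ∧ H v ∧ ∃ u, G.Adj u v ∧ x ∈ front j u ∧ (front j u).ncard ≤ τ}

variable {G H src lev τ}

theorem exists_chain_of_mem_front (hsrc : ∀ v, src v → H v) {j : ℕ} {v x : V}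
    (hx : x ∈ front G H src lev τ j v) : ∃ f : ℕ → V, f 0 = x ∧ f j = v ∧
      (∀ i ≤ j, lev (f i) = i ∧ H (f i)) ∧ ∀ i < j, G.Adj (f i) (f (i + 1)) := by
  induction j generalizing v with
  | zero =>
    obtain ⟨rfl, h0, hs⟩ := hx
    exact ⟨fun _ => x, rfl, rfl, fun i hi => by
      obtain rfl := Nat.le_zero.1 hi; exact ⟨h0, hsrc _ hs⟩, by simp⟩
  | succ j ih =>
    obtain ⟨hl, hH, u, hu, hxu, -⟩ := hx
    obtain ⟨f, h0, hj, hf, hadj⟩ := ih hxu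
    refine ⟨fun i => if i ≤ j then f i else v, by simp [h0], by simp, fun i hi => ?_,
      fun i hi => ?_⟩
    · by_cases h : i ≤ j
      · simp [h, hf i h]
      · obtain rfl : i = j + 1 := by omega
        simp [hl, hH]
    · by_cases h : i + 1 ≤ j
      · simpa [h, show i ≤ j by omega] using hadj i h
      · obtain rfl : i = j := by omega
        simpa [hj] using hu

theorem src_of_mem_front {j : ℕ} {v x : V} (hx : x ∈ front G H src lev τ j v) : src x := by
  induction j generalizing v with
  | zero => obtain ⟨rfl, -, h⟩ := hx; exact h
  | succ j ih => obtain ⟨-, -, u, -, hu, -⟩ := hx; exact ih hu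

/-- Completeness of the search: a source can be lost only at an overloaded vertex, and only the
levels below `k` forward anything. -/
theorem mem_front_of_chain {k : ℕ} (z : ℕ → V) (hlev : ∀ i ≤ k, lev (z i) = i)
    (hH : ∀ i ≤ k, H (z i)) (hsrc : src (z 0)) (hadj : ∀ i < k, G.Adj (z i) (z (i + 1)))
    (hτ : ∀ i < k, (front G H src lev τ i (z i)).ncard ≤ τ) : z 0 ∈ front G H src lev τ k (z k) := by
  suffices ∀ i ≤ k, z 0 ∈ front G H src lev τ i (z i) from this k le_rfl
  intro i
  induction i with
  | zero => exact fun _ => ⟨rfl, hlev 0 (Nat.zero_le _), hsrc⟩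
  | succ i ih => exact fun hi => ⟨hlev _ hi, hH _ hi, z i, hadj i (by omega), ih (by omega),
      hτ i (by omega)⟩

theorem ncard_front_le_of_src [Finite V] {S : Set V} (hS : ∀ v, src v → v ∈ S) (j : ℕ) (v : V) :
    (front G H src lev τ j v).ncard ≤ S.ncard :=
  Set.ncard_le_ncard fun _ hx => hS _ (src_of_mem_front hx)

theorem ncard_front_zero_le (v : V) : (front G H src lev τ 0 v).ncard ≤ 1 :=
  (Set.ncard_le_ncard (t := {v}) fun _ hx => hx.1).trans (by simp)

theorem ncard_front_le_pow [Finite V] {D : ℕ} (hD : ∀ v, H v → (G.neighborSet v).ncard ≤ D) (j : ℕ)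
    (v : V) : (front G H src lev τ j v).ncard ≤ D ^ j := by
  classical
  have := Fintype.ofFinite V
  induction j generalizing v with
  | zero => simpa using ncard_front_zero_le v
  | succ j ih =>
    by_cases hH : H v
    · have hsub : front G H src lev τ (j + 1) v ⊆
          ⋃ u ∈ (G.neighborSet v).toFinset, front G H src lev τ j u := by
        rintro x ⟨-, -, u, hu, hx, -⟩
        simp only [Set.mem_toFinset, Set.mem_iUnion, mem_neighborSet]
        exact ⟨u, hu.symm, hx⟩
      refine (Set.ncard_le_ncard hsub).trans ?_
      refine (Finset.set_ncard_biUnion_le _ _).trans ?_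
      refine (Finset.sum_le_card_nsmul _ _ (D ^ j) fun u _ => ih u).trans ?_
      rw [smul_eq_mul, pow_succ', ← Set.ncard_eq_toFinset_card']
      exact Nat.mul_le_mul_right _ (hD v hH)
    · have : front G H src lev τ (j + 1) v = ∅ := by
        ext x
        simp only [Set.mem_empty_iff_false, iff_false]
        exact fun hx => hH hx.2.1
      simp [this]

/-- If the sources have many neighbours in a set `S` that the search avoids, and no cycle of length
`2 * k` meets `S`, then no vertex hears of many sources. -/
theorem ncard_front_le_of_not_cycleThrough [Finite V] {k j : ℕ} (hj : 1 ≤ j) (hjk : j < k)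
    {S : Set V} (hsrc : ∀ v, src v → H v) (hHS : ∀ v, H v → v ∉ S)
    (hdeg : ∀ v, src v → 2 * k ^ 2 ≤ {s ∈ S | G.Adj s v}.ncard)
    (hcyc : ∀ s ∈ S, ¬ CycleThrough G (2 * k) s) (v : V) :
    (front G H src lev τ j v).ncard ≤ k * S.ncard := by
  classical
  have := Fintype.ofFinite V
  -- `up i y`: some chain climbs level by level from `y` to `v` inside `H`. Choosing one parent per
  -- vertex, independently of the leaf below it, turns the chains into a tree with root `v`.
  let up : ℕ → V → Prop := fun i y => ∃ f : ℕ → V, f i = y ∧ f j = v ∧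
    (∀ t, i ≤ t → t ≤ j → lev (f t) = t ∧ H (f t)) ∧ ∀ t, i ≤ t → t < j → G.Adj (f t) (f (t + 1))
  have hparent : ∀ y, ∃ y', lev y < j → up (lev y) y → G.Adj y y' ∧ up (lev y + 1) y' := by
    intro y
    by_cases hy : lev y < j ∧ up (lev y) y
    · obtain ⟨hlt, f, hfi, hfj, hf, hadj⟩ := hy
      refine ⟨f (lev y + 1), fun _ _ => ⟨?_, f, rfl, hfj, fun t ht => hf t (by omega),
        fun t ht => hadj t (by omega)⟩⟩
      simpa only [hfi] using hadj (lev y) le_rfl hlt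
    · exact ⟨y, fun h1 h2 => absurd ⟨h1, h2⟩ hy⟩
  choose π hπ using hparent
  have hup : ∀ w ∈ front G H src lev τ j v, ∀ i ≤ j, lev (π^[i] w) = i ∧ up i (π^[i] w) := by
    intro w hw i
    induction i with
    | zero =>
      obtain ⟨f, h0, hfj, hf, hadj⟩ := exists_chain_of_mem_front hsrc hw
      refine fun _ => ⟨?_, f, h0, hfj, fun t _ => hf t, fun t _ => hadj t⟩
      rw [Function.iterate_zero, id, ← h0]
      exact (hf 0 (Nat.zero_le _)).1
    | succ i ih =>
      intro hi
      obtain ⟨h1, h2⟩ := ih (by omega)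
      have h3 := (hπ (π^[i] w) (by omega) (by rwa [h1])).2
      rw [h1, ← Function.iterate_succ_apply' π] at h3
      refine ⟨?_, h3⟩
      obtain ⟨f, hfi, -, hf, -⟩ := h3
      rw [← hfi]
      exact (hf (i + 1) le_rfl hi).1
  by_contra! hlt
  obtain ⟨s, hs, hc⟩ := exists_cycleThrough_of_dense hj hjk (front G H src lev τ j v).toFinset
    S.toFinset π lev v (fun w hw i hi => (hup w (by simpa using hw) i hi).1)
    (fun w hw i hi => by
      obtain ⟨h1, f, hfi, -, hf, -⟩ := hup w (by simpa using hw) i hi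
      have := hHS _ (hf i le_rfl hi).2
      rw [hfi] at this
      simpa using this)
    (fun w hw i hi => by
      obtain ⟨h1, h2⟩ := hup w (by simpa using hw) i hi.le
      rw [Function.iterate_succ_apply']
      exact (hπ (π^[i] w) (by omega) (by rwa [h1])).1)
    (fun w hw => by
      obtain ⟨h1, f, hfi, hfj, -⟩ := hup w (by simpa using hw) j le_rfl
      exact hfi.symm.trans hfj)
    (fun w hw => by
      refine (hdeg w (src_of_mem_front (by simpa using hw))).trans_eq ?_
      rw [Set.ncard_eq_toFinset_card']
      congr 1
      ext s
      simp)
    (by rwa [← Set.ncard_eq_toFinset_card', ← Set.ncard_eq_toFinset_card'])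
  exact hcyc s (by simpa using hs) hc

end Front

/-- The distance of the colour `c` from the colour `0` along one of the sides of a cycle with the
colours `0, …, 2 * k - 1` in order; it is meaningful up to `k`. -/
def sideLevel (k : ℕ) (b : Bool) (c : ℕ) : ℕ := if b then c else if c = 0 then 0 else 2 * k - c

/-! ### Meeting of the two searches -/

section Meet
variable {V : Type*} {G : SimpleGraph V} {k τ : ℕ} {c : V → ℕ}

/-- What two searches along the sides have in common at a vertex of the last level lies on a
cycle. -/
theorem hasCycleOfLength_of_mem_front (hk : 2 ≤ k) {H src : V → Prop} (hsrc : ∀ v, src v → H v)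
    {x v : V} (h₁ : x ∈ front G H src (fun v => sideLevel k true (c v)) τ k v)
    (h₂ : x ∈ front G H src (fun v => sideLevel k false (c v)) τ k v) :
    HasCycleOfLength G (2 * k) := by
  obtain ⟨f, hf0, hfk, hf, hfa⟩ := exists_chain_of_mem_front hsrc h₁
  obtain ⟨g, hg0, hgk, hg, hga⟩ := exists_chain_of_mem_front hsrc h₂
  simp only [sideLevel, if_true, Bool.false_eq_true, if_false] at hf hg
  obtain ⟨p, hp, hpl, hps⟩ := exists_path_of_adj_succ f k hfa fun i hi j hj h => by
    rw [← (hf i hi).1, ← (hf j hj).1, h]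
  obtain ⟨q, hq, hql, hqs⟩ := exists_path_of_adj_succ g k hga fun i hi j hj h => by
    rw [← (hg i hi).1, ← (hg j hj).1, h]
  subst hf0
  subst hfk
  obtain ⟨q', hq', hql', hqs'⟩ : ∃ q' : G.Walk (f 0) (f k), q'.IsPath ∧ q'.length = k ∧
      ∀ y, y ∈ q'.support ↔ ∃ i ≤ k, g i = y :=
    ⟨q.copy hg0 hgk, by simpa using hq, by simpa using hql, by simpa using hqs⟩
  -- The colours on the two sides agree only at level 0 and at level `k`, so the two paths share
  -- only their ends.
  obtain ⟨C, hC, hCl, -⟩ := exists_isCycle_of_paths p q' hp hq' (fun y hy hy' => by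
    obtain ⟨i, hi, rfl⟩ := (hps y).1 hy
    obtain ⟨j, hj, hij⟩ := (hqs' _).1 hy'
    have h1 := (hf i hi).1
    have h2 := (hg j hj).1
    rw [hij, h1] at h2
    rcases Nat.eq_zero_or_pos i with h0 | h0
    · exact .inl (by rw [h0])
    · rw [if_neg (by omega)] at h2
      exact .inr (by rw [show i = k by omega]))
    (fun h => by
      have h1 := (hf 0 (by omega)).1
      rw [h, (hf k le_rfl).1] at h1
      omega) (by omega)
  exact ⟨_, C, hC, by omega⟩

/-- The searches along both sides of a well-coloured cycle meet, if no vertex of the cycle has to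
remain silent. -/
theorem exists_mem_front_of_isCycleSeq (hk : 0 < k) {H src : V → Prop} {z : ℕ → V}
    (hz : IsCycleSeq G (2 * k) z) (hc : ∀ i < 2 * k, c (z i) = i) (hH : ∀ i < 2 * k, H (z i))
    (hsrc : src (z 0))
    (hτ : ∀ b, ∀ i < k, ∀ v, (front G H src (fun v => sideLevel k b (c v)) τ i v).ncard ≤ τ) :
    ∃ x v, ∀ b, x ∈ front G H src (fun v => sideLevel k b (c v)) τ k v := by
  have hH' : ∀ i ≤ 2 * k, H (z i) := fun i hi => by
    rcases hi.eq_or_lt with rfl | h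
    · rw [hz.closed]; exact hH 0 (by omega)
    · exact hH i h
  refine ⟨z 0, z k, fun b => ?_⟩
  cases b with
  | true =>
    exact mem_front_of_chain z (fun i hi => by simpa [sideLevel] using hc i (by omega))
      (fun i hi => hH i (by omega)) hsrc (fun i hi => hz.adj i (by omega)) fun i hi => hτ _ i hi _
  | false =>
    -- The other side is the cycle traversed backwards; its first vertex `z (2 * k)` is `z 0`, which
    -- is why `sideLevel` treats colour 0 separately.
    have := mem_front_of_chain (G := G) (H := H) (src := src) (τ := τ) (k := k)
      (lev := fun v => sideLevel k false (c v)) (fun i => z (2 * k - i)) (fun i hi => by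
        rcases Nat.eq_zero_or_pos i with rfl | h
        · simp [sideLevel, hz.closed, hc 0 (by omega)]
        · simp only [sideLevel, Bool.false_eq_true, if_false]
          rw [hc (2 * k - i) (by omega), if_neg (by omega)]
          omega)
      (fun i hi => hH' _ (by omega)) (by simpa [hz.closed] using hsrc) (fun i hi => by
        have := (hz.adj (2 * k - (i + 1)) (by omega)).symm
        rwa [show 2 * k - (i + 1) + 1 = 2 * k - i by omega] at this)
      fun i hi => hτ _ i hi _
    simpa [hz.closed, show 2 * k - k = k by omega] using this

end Meet
end Congest

/-! ### Simulating broadcast phases by rounds -/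

namespace Congest

/-- A program for a network in which a node broadcasts, in each phase `t`, a finite set of items,
and learns which items were broadcast by some neighbour. -/
structure BroadcastProgram (ι : Type) where
  Seed : Type
  [seedFintype : Fintype Seed]
  [seedNonempty : Nonempty Seed]
  State : Type
  start : ℕ → Set ℕ → Seed → State
  say : ℕ → State → Finset ι
  hear : ℕ → State → Set ι → State
  rejects : State → Bool

attribute [instance] BroadcastProgram.seedFintype BroadcastProgram.seedNonempty

namespace BroadcastProgram
variable {ι : Type} (Q : BroadcastProgram ι) {V : Type*} (G : SimpleGraph V) (ident : V → ℕ)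
  (seed : V → Q.Seed)

/-- The states of the nodes after `t` phases. -/
def run : ℕ → V → Q.State
  | 0 => fun v => Q.start (ident v) (ident '' G.neighborSet v) (seed v)
  | t + 1 => fun v => Q.hear t (run t v) {x | ∃ u, G.Adj u v ∧ x ∈ Q.say t (run t u)}

theorem run_succ (t : ℕ) (v : V) : Q.run G ident seed (t + 1) v =
    Q.hear t (Q.run G ident seed t v) {x | ∃ u, G.Adj u v ∧ x ∈ Q.say t (Q.run G ident seed t u)} :=
  rfl

open Classical in
/-- The implementation that spends `L` rounds on each phase and sends one item in each round. A node
keeps the number of the current round and the items that it has received in the current phase. -/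
noncomputable def toNodeProgram {b : ℕ} (enc : ι → Message b) (L : ℕ) : NodeProgram b where
  Seed := Q.Seed
  State := Q.State × ℕ × Set ι
  start i N r := (Q.start i N r, 0, ∅)
  send s _ := ((Q.say (s.2.1 / L) s.1).toList[s.2.1 % L]?).map enc
  receive s inbox :=
    if (s.2.1 + 1) % L = 0 then
      (Q.hear (s.2.1 / L) s.1 (s.2.2 ∪ {x | ∃ j, inbox j = some (enc x)}), s.2.1 + 1, ∅)
    else (s.1, s.2.1 + 1, s.2.2 ∪ {x | ∃ j, inbox j = some (enc x)})
  rejects s := Q.rejects s.1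

variable {Q G ident seed} {b : ℕ} {enc : ι → Message b} {L : ℕ}

theorem exists_inbox_eq_some_iff {P : NodeProgram b} (hid : Function.Injective ident)
    (s : V → P.State) (v : V) (m : Message b) :
    (∃ j, inbox P G ident s v j = some m) ↔
      ∃ u, G.Adj u v ∧ P.send (s u) (ident v) = some m := by
  constructor
  · rintro ⟨j, hj⟩
    by_cases h : ∃ u, ident u = j
    · obtain ⟨u, rfl⟩ := h
      rw [inbox, hid.extend_apply] at hj
      by_cases ha : G.Adj u v
      · exact ⟨u, ha, by simpa [ha] using hj⟩
      · simp [ha] at hj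
    · rw [inbox, Function.extend_apply' _ _ _ h] at hj
      simp at hj
  · rintro ⟨u, ha, hu⟩
    exact ⟨ident u, by rw [inbox, hid.extend_apply, if_pos ha, hu]⟩

/-- The invariant is tracked at every round: inside a phase the buffer holds the first `i` items of
each neighbour. Since no node has more than `L` items, the buffer is complete when the phase ends.
-/
theorem stateAfter_toNodeProgram (henc : Function.Injective enc) (hid : Function.Injective ident)
    (hL : 0 < L) (hsay : ∀ t v, (Q.say t (Q.run G ident seed t v)).card ≤ L) (t i : ℕ)
    (hi : i < L) (v : V) :
    stateAfter (Q.toNodeProgram enc L) G ident seed (L * t + i) v =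
      (Q.run G ident seed t v, L * t + i,
        {x | ∃ u, G.Adj u v ∧ x ∈ (Q.say t (Q.run G ident seed t u)).toList.take i}) := by
  suffices ∀ r v, stateAfter (Q.toNodeProgram enc L) G ident seed r v =
      (Q.run G ident seed (r / L) v, r, {x | ∃ u, G.Adj u v ∧
        x ∈ (Q.say (r / L) (Q.run G ident seed (r / L) u)).toList.take (r % L)}) by
    rw [this, Nat.mul_add_div hL, Nat.div_eq_of_lt hi, Nat.mul_add_mod, Nat.mod_eq_of_lt hi,
      add_zero]
  intro r
  induction r with
  | zero => intro v; simp [stateAfter, toNodeProgram, run]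
  | succ r ih =>
    intro v
    have hsend : ∀ (s : Q.State) (B : Set ι) (j : ℕ), (Q.toNodeProgram enc L).send (s, r, B) j =
        ((Q.say (r / L) s).toList[r % L]?).map enc := fun _ _ _ => rfl
    have hset : ({x | ∃ u, G.Adj u v ∧
          x ∈ (Q.say (r / L) (Q.run G ident seed (r / L) u)).toList.take (r % L)} ∪
        {x | ∃ j, inbox (Q.toNodeProgram enc L) G ident
          (stateAfter (Q.toNodeProgram enc L) G ident seed r) v j = some (enc x)}) =
        {x | ∃ u, G.Adj u v ∧
          x ∈ (Q.say (r / L) (Q.run G ident seed (r / L) u)).toList.take (r % L + 1)} := by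
      ext x
      simp only [Set.mem_union, Set.mem_ofPred_eq, exists_inbox_eq_some_iff hid, ih,
        hsend, Option.map_eq_some_iff, List.take_add_one, List.mem_append,
        Option.mem_toList, henc.eq_iff, exists_eq_right]
      constructor
      · rintro (⟨u, h1, h2⟩ | ⟨u, h1, h2⟩)
        · exact ⟨u, h1, .inl h2⟩
        · exact ⟨u, h1, .inr h2⟩
      · rintro ⟨u, h1, h2 | h2⟩
        · exact .inl ⟨u, h1, h2⟩
        · exact .inr ⟨u, h1, h2⟩
    have hstep : stateAfter (Q.toNodeProgram enc L) G ident seed (r + 1) v =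
        (Q.toNodeProgram enc L).receive (stateAfter (Q.toNodeProgram enc L) G ident seed r v)
          (inbox (Q.toNodeProgram enc L) G ident
            (stateAfter (Q.toNodeProgram enc L) G ident seed r) v) := rfl
    rw [hstep, ih v]
    have hrec : ∀ (s : Q.State) (B : Set ι) (ib : ℕ → Option (Message b)),
        (Q.toNodeProgram enc L).receive (s, r, B) ib = if (r + 1) % L = 0 then
          (Q.hear (r / L) s (B ∪ {x | ∃ j, ib j = some (enc x)}), r + 1, ∅)
          else (s, r + 1, B ∪ {x | ∃ j, ib j = some (enc x)}) := fun _ _ _ => rfl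
    rw [hrec, hset]
    have hdm := Nat.div_add_mod r L
    have hlt := Nat.mod_lt r hL
    by_cases hmod : r % L + 1 = L
    · have hr : r + 1 = L * (r / L + 1) := by rw [mul_add]; omega
      have h1 : (r + 1) / L = r / L + 1 := by rw [hr, Nat.mul_div_cancel_left _ hL]
      have h2 : (r + 1) % L = 0 := by rw [hr, Nat.mul_mod_right]
      rw [if_pos h2, h1, h2, hmod]
      simp only [List.take_zero, List.not_mem_nil, and_false, exists_false, Set.ofPred_false, run]
      congr 2
      ext x
      simp only [Set.mem_ofPred_eq]
      refine exists_congr fun u => and_congr_right fun _ => ?_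
      rw [List.take_of_length_le (by rw [Finset.length_toList]; exact hsay _ _), Finset.mem_toList]
    · have hr : r + 1 = L * (r / L) + (r % L + 1) := by omega
      have h1 : (r + 1) / L = r / L := by
        conv_lhs => rw [hr, Nat.mul_add_div hL,
          Nat.div_eq_of_lt (show r % L + 1 < L by omega), add_zero]
      have h2 : (r + 1) % L = r % L + 1 := by
        conv_lhs => rw [hr, Nat.mul_add_mod,
          Nat.mod_eq_of_lt (show r % L + 1 < L by omega)]
      rw [if_neg (by omega), h1, h2]

/-- After `L` rounds for each of `T` phases the implementation is in the intended state. -/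
theorem rejects_stateAfter_toNodeProgram (henc : Function.Injective enc)
    (hid : Function.Injective ident) (hL : 0 < L)
    (hsay : ∀ t v, (Q.say t (Q.run G ident seed t v)).card ≤ L) (T : ℕ) (v : V) :
    (Q.toNodeProgram enc L).rejects (stateAfter (Q.toNodeProgram enc L) G ident seed (L * T) v) =
      Q.rejects (Q.run G ident seed T v) := by
  have := stateAfter_toNodeProgram henc hid hL hsay T 0 hL v
  rw [add_zero] at this
  rw [this]
  rfl

end BroadcastProgram
end Congest

/-! ### The detection algorithm -/

namespace Congest
open SimpleGraph

/-- The nodes that take part in the search `p`: those of degree at most `D`, all nodes, or those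
that are not selected. -/
def MayRelay (D : ℕ) (p : Fin 3) (deg : ℕ) (sel : Prop) : Prop :=
  match p with
  | 0 => deg ≤ D
  | 1 => True
  | 2 => ¬ sel

/-- The nodes from which the search `p` starts: those of degree at most `D`, the selected nodes, or
those with many selected neighbours that are not selected themselves. -/
def MayStart (D : ℕ) (p : Fin 3) (deg : ℕ) (sel rich : Prop) : Prop :=
  match p with
  | 0 => deg ≤ D
  | 1 => sel
  | 2 => ¬ sel ∧ rich

theorem MayStart.mayRelay {D : ℕ} {p : Fin 3} {deg : ℕ} {sel rich : Prop}
    (h : MayStart D p deg sel rich) : MayRelay D p deg sel := by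
  fin_cases p
  · exact h
  · trivial
  · exact h.1

section Search
variable {V : Type*} (G : SimpleGraph V) (k R D τ : ℕ) (sel : V → Prop) (col : V → Fin R → ℕ)

/-- `v` has many selected neighbours. -/
def IsRich (v : V) : Prop := 2 * k ^ 2 ≤ {s | sel s ∧ G.Adj s v}.ncard

/-- The search in repetition `ch.1`, of kind `ch.2.1`, along side `ch.2.2` of the cycle. -/
def search (ch : Fin R × Fin 3 × Bool) : ℕ → V → Set V :=
  front G (fun v => MayRelay D ch.2.1 (G.neighborSet v).ncard (sel v))
    (fun v => MayStart D ch.2.1 (G.neighborSet v).ncard (sel v) (IsRich G k sel v))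
    (fun v => sideLevel k ch.2.2 (col v ch.1)) τ

/-- The searches along both sides meet at `v`. -/
def DetectedAt (v : V) : Prop := ∃ r p x, ∀ b, x ∈ search G k R D τ sel col (r, p, b) k v

variable {G k R D τ sel col}

theorem DetectedAt.hasCycleOfLength (hk : 2 ≤ k) {v : V} (h : DetectedAt G k R D τ sel col v) :
    HasCycleOfLength G (2 * k) := by
  obtain ⟨r, p, x, hx⟩ := h
  exact hasCycleOfLength_of_mem_front hk (fun v => MayStart.mayRelay) (hx true) (hx false)

/-- A cycle that is not light is rotated so that a heavy vertex comes first, where the search has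
its source. -/
theorem exists_isCycleSeq_light_or_heavy (h : HasCycleOfLength G (2 * k)) (hk : 2 ≤ k) (D : ℕ) :
    ∃ z, IsCycleSeq G (2 * k) z ∧
      ((∀ i < 2 * k, (G.neighborSet (z i)).ncard ≤ D) ∨ D < (G.neighborSet (z 0)).ncard) := by
  classical
  obtain ⟨v, p, hp⟩ := h
  obtain ⟨z, hz, -⟩ := CycleThrough.exists_seq (v := v) ⟨p, hp⟩
  by_cases hl : ∀ i < 2 * k, (G.neighborSet (z i)).ncard ≤ D
  · exact ⟨z, hz, .inl hl⟩
  · push Not at hl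
    obtain ⟨i, hi, hD⟩ := hl
    obtain ⟨z', hz', h0⟩ := (hz.cycleThrough (by omega) i hi).exists_seq
    exact ⟨z', hz', .inr (by rwa [h0])⟩

/-- Whatever the selected nodes are, as long as they are few: if there is a cycle of nodes of small
degree, or a cycle through a node with many selected neighbours, then there is a cycle such that
every colouring that is right on it leads to a detection. -/
theorem exists_isCycleSeq_detected [Finite V] (hk : 2 ≤ k) (h1 : 1 ≤ τ) (hD1 : 1 ≤ D)
    (hD : D ^ (k - 1) ≤ τ) (hS : k * {v | sel v}.ncard ≤ τ) {z : ℕ → V}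
    (hz : IsCycleSeq G (2 * k) z)
    (h : (∀ i < 2 * k, (G.neighborSet (z i)).ncard ≤ D) ∨ IsRich G k sel (z 0)) :
    ∃ z', IsCycleSeq G (2 * k) z' ∧ ∀ col : V → Fin R → ℕ, ∀ r,
      (∀ i < 2 * k, col (z' i) r = i) → ∃ v, DetectedAt G k R D τ sel col v := by
  classical
  -- If a selected vertex lies on a 2k-cycle, that cycle replaces the given one. Otherwise no
  -- 2k-cycle meets the selected set, so the given cycle avoids it and the density bound applies.
  by_cases hc : ∃ s, sel s ∧ CycleThrough G (2 * k) s
  · obtain ⟨s, hs, hc⟩ := hc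
    obtain ⟨z', hz', h0⟩ := hc.exists_seq
    refine ⟨z', hz', fun col r hcol => ?_⟩
    obtain ⟨x, v, hx⟩ := exists_mem_front_of_isCycleSeq (by omega)
      (H := fun v => MayRelay D 1 (G.neighborSet v).ncard (sel v))
      (src := fun v => MayStart D 1 (G.neighborSet v).ncard (sel v) (IsRich G k sel v))
      (τ := τ) (c := fun v => col v r) hz' hcol (fun _ _ => trivial) (show sel (z' 0) by rwa [h0])
      fun b i hi v => (ncard_front_le_of_src (S := {v | sel v}) (fun _ h => h) i v).trans
        ((Nat.le_mul_of_pos_left _ (by omega)).trans hS)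
    exact ⟨v, r, 1, x, hx⟩
  push Not at hc
  refine ⟨z, hz, fun col r hcol => ?_⟩
  rcases h with h | h
  · obtain ⟨x, v, hx⟩ := exists_mem_front_of_isCycleSeq (by omega)
      (H := fun v => MayRelay D 0 (G.neighborSet v).ncard (sel v))
      (src := fun v => MayStart D 0 (G.neighborSet v).ncard (sel v) (IsRich G k sel v))
      (τ := τ) (c := fun v => col v r) hz hcol h (h 0 (by omega))
      fun b i hi v => (ncard_front_le_pow (D := D) (fun _ h => h) i v).trans
        ((Nat.pow_le_pow_right hD1 (by omega)).trans hD)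
    exact ⟨v, r, 0, x, hx⟩
  · have hsel : ∀ i < 2 * k, ¬ sel (z i) := fun i hi hs =>
      hc _ hs (hz.cycleThrough (by omega) i hi)
    obtain ⟨x, v, hx⟩ := exists_mem_front_of_isCycleSeq (by omega)
      (H := fun v => MayRelay D 2 (G.neighborSet v).ncard (sel v))
      (src := fun v => MayStart D 2 (G.neighborSet v).ncard (sel v) (IsRich G k sel v))
      (τ := τ) (c := fun v => col v r) hz hcol hsel ⟨hsel 0 (by omega), h⟩
      fun b i hi v => by
        -- The density bound needs a positive level; at level 0 a vertex knows at most itself.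
        rcases Nat.eq_zero_or_pos i with rfl | hi0
        · exact (ncard_front_zero_le v).trans h1
        · exact (ncard_front_le_of_not_cycleThrough hi0 hi (S := {v | sel v})
            (H := fun v => MayRelay D 2 (G.neighborSet v).ncard (sel v))
            (src := fun v => MayStart D 2 (G.neighborSet v).ncard (sel v) (IsRich G k sel v))
            (fun _ h => MayStart.mayRelay h) (fun _ h => h) (fun v h => h.2) hc v).trans hS
    exact ⟨v, r, 2, x, hx⟩

end Search

/-- What a node of the cycle detection algorithm knows. -/
structure CycleState (R M : ℕ) where
  me : Fin (M + 1)
  deg : ℕ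
  sel : Prop
  col : Fin R → ℕ
  rich : Prop
  heard : Fin R × Fin 3 × Bool → Set (Fin (M + 1))

open Classical in
/-- The cycle detection algorithm: in phase `0` the selected nodes identify themselves, in the
following phases all searches advance in parallel. -/
noncomputable def cycleProgram (k R M D τ : ℕ) (α β : Type) [Fintype α] [Nonempty α] [Fintype β]
    [Nonempty β] (selected : α → Prop) (colour : β → Fin R → ℕ) :
    BroadcastProgram (Option (Fin R × Fin 3 × Bool) × Fin (M + 1)) where
  Seed := α × β
  State := CycleState R M
  start i N r := ⟨Fin.ofNat (M + 1) i, N.ncard, selected r.1, colour r.2, False, fun _ => ∅⟩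
  say t s := match t with
    | 0 => if s.sel then {(none, s.me)} else ∅
    | _ + 1 => Finset.univ.biUnion fun ch => if (s.heard ch).ncard ≤ τ then
        (s.heard ch).toFinset.image fun i => (some ch, i) else ∅
  hear t s X := match t with
    | 0 => { s with
        rich := 2 * k ^ 2 ≤ {i | (none, i) ∈ X}.ncard
        heard := fun ch => {i | i = s.me ∧ sideLevel k ch.2.2 (s.col ch.1) = 0 ∧
          MayStart D ch.2.1 s.deg s.sel (2 * k ^ 2 ≤ {i | (none, i) ∈ X}.ncard)} }
    | t + 1 => { s with
        heard := fun ch => {i | sideLevel k ch.2.2 (s.col ch.1) = t + 1 ∧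
          MayRelay D ch.2.1 s.deg s.sel ∧ (some ch, i) ∈ X} }
  rejects s := decide (∃ r p x, ∀ b, x ∈ s.heard (r, p, b))

section Run
variable {k R M D τ : ℕ} {α β : Type} [Fintype α] [Nonempty α] [Fintype β] [Nonempty β]
  {selected : α → Prop} {colour : β → Fin R → ℕ} {V : Type*} {G : SimpleGraph V} {ident : V → ℕ}
  {seed : V → α × β}

/-- Phase 0 is spent on announcing the selected nodes and initialising level 0, so the searches lag
one phase behind and finish after `k + 1` phases. -/
theorem cycleProgram_run_succ (hid : Function.Injective fun v => Fin.ofNat (M + 1) (ident v))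
    (hid' : Function.Injective ident) (t : ℕ) (v : V) :
    (cycleProgram k R M D τ α β selected colour).run G ident seed (t + 1) v =
      ⟨Fin.ofNat (M + 1) (ident v), (G.neighborSet v).ncard, selected (seed v).1,
        colour (seed v).2, IsRich G k (fun u => selected (seed u).1) v,
        fun ch => (fun v => Fin.ofNat (M + 1) (ident v)) '' search G k R D τ
          (fun u => selected (seed u).1) (fun u => colour (seed u).2) ch t v⟩ := by
  classical
  induction t generalizing v with
  | zero =>
    have hset : {i | ((none : Option (Fin R × Fin 3 × Bool)), i) ∈ {x | ∃ u, G.Adj u v ∧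
        x ∈ (cycleProgram k R M D τ α β selected colour).say 0
          ((cycleProgram k R M D τ α β selected colour).run G ident seed 0 u)}} =
        (fun v => Fin.ofNat (M + 1) (ident v)) '' {s | selected (seed s).1 ∧ G.Adj s v} := by
      ext i
      simp only [cycleProgram, BroadcastProgram.run, Set.mem_ofPred_eq, Set.mem_image]
      refine exists_congr fun u => ?_
      split_ifs with h <;> simp [h, eq_comm]
    have hrich : 2 * k ^ 2 ≤ {i | ((none : Option (Fin R × Fin 3 × Bool)), i) ∈ {x | ∃ u,
        G.Adj u v ∧ x ∈ (cycleProgram k R M D τ α β selected colour).say 0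
          ((cycleProgram k R M D τ α β selected colour).run G ident seed 0 u)}}.ncard ↔
        IsRich G k (fun u => selected (seed u).1) v := by
      rw [hset, Set.ncard_image_of_injective _ hid, IsRich]
    have hdeg : (ident '' G.neighborSet v).ncard = (G.neighborSet v).ncard :=
      Set.ncard_image_of_injective _ hid'
    refine (BroadcastProgram.run_succ ..).trans ?_
    generalize {x | ∃ u, G.Adj u v ∧ x ∈ (cycleProgram k R M D τ α β selected colour).say 0
          ((cycleProgram k R M D τ α β selected colour).run G ident seed 0 u)} = X at hrich
    simp only [cycleProgram, BroadcastProgram.run, hdeg, hrich, search, front]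
    congr 1
    funext ch
    ext i
    simp only [Set.mem_ofPred_eq, Set.mem_image]
    constructor
    · rintro ⟨rfl, h⟩
      exact ⟨v, ⟨rfl, h⟩, rfl⟩
    · rintro ⟨_, ⟨rfl, h⟩, rfl⟩
      exact ⟨rfl, h⟩
  | succ t ih =>
    refine (BroadcastProgram.run_succ ..).trans ?_
    simp only [ih]
    simp only [cycleProgram, search]
    congr 1
    funext ch
    ext i
    simp only [Set.mem_ofPred_eq, Set.mem_image, front]
    constructor
    · rintro ⟨h1, h2, u, hu, hi⟩
      rw [Finset.mem_biUnion] at hi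
      obtain ⟨ch', -, hi⟩ := hi
      split_ifs at hi with hn
      · simp only [Finset.mem_image, Set.mem_toFinset, Set.mem_image, Prod.mk.injEq,
          Option.some.injEq] at hi
        obtain ⟨_, ⟨x, hx, rfl⟩, rfl, rfl⟩ := hi
        rw [Set.ncard_image_of_injective _ hid] at hn
        exact ⟨x, ⟨h1, h2, u, hu, hx, hn⟩, rfl⟩
      · simp at hi
    · rintro ⟨x, ⟨h1, h2, u, hu, hx, hn⟩, rfl⟩
      refine ⟨h1, h2, u, hu, ?_⟩
      rw [Finset.mem_biUnion]
      refine ⟨ch, Finset.mem_univ _, ?_⟩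
      rw [if_pos (by rwa [Set.ncard_image_of_injective _ hid])]
      simp only [Finset.mem_image, Set.mem_toFinset]
      exact ⟨_, ⟨x, hx, rfl⟩, rfl⟩

theorem card_say_cycleProgram_le (t : ℕ) (s : CycleState R M) :
    ((cycleProgram k R M D τ α β selected colour).say t s).card ≤ 6 * R * τ + 1 := by
  classical
  cases t with
  | zero =>
    simp only [cycleProgram]
    split_ifs <;> simp
  | succ t =>
    simp only [cycleProgram]
    refine (Finset.card_biUnion_le_card_mul _ _ τ fun ch _ => ?_).trans ?_
    · split_ifs with h
      · refine Finset.card_image_le.trans ?_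
        rwa [← Set.ncard_eq_toFinset_card']
      · simp
    · simp only [Finset.card_univ, Fintype.card_prod, Fintype.card_fin, Fintype.card_bool]
      refine Nat.le_succ_of_le (le_of_eq ?_)
      ring

theorem cycleProgram_rejects_iff (hid : Function.Injective fun v => Fin.ofNat (M + 1) (ident v))
    (hid' : Function.Injective ident) (v : V) :
    (cycleProgram k R M D τ α β selected colour).rejects
      ((cycleProgram k R M D τ α β selected colour).run G ident seed (k + 1) v) = true ↔
      DetectedAt G k R D τ (fun u => selected (seed u).1) (fun u => colour (seed u).2) v := by
  rw [cycleProgram_run_succ hid hid']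
  simp only [cycleProgram, decide_eq_true_eq, DetectedAt]
  refine exists_congr fun r => exists_congr fun p => ?_
  constructor
  · rintro ⟨x, hx⟩
    obtain ⟨y, hy, rfl⟩ := hx true
    refine ⟨y, fun b => ?_⟩
    obtain ⟨y', hy', h⟩ := hx b
    rwa [← hid h]
  · rintro ⟨x, hx⟩
    exact ⟨_, fun b => ⟨x, hx b, rfl⟩⟩

end Run
end Congest

/-! ### Probability estimates by counting -/

namespace Congest
open Finset

section Counting
variable {V α : Type*} [Fintype V] [DecidableEq V] [Fintype α] [DecidableEq α]

/-- Independence of the values at different nodes, in a form without division. -/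
theorem card_filter_forall_mem_mul (N : Finset V) (T : V → Finset α) :
    #{f : V → α | ∀ v ∈ N, f v ∈ T v} * Fintype.card α ^ #N =
      (∏ v ∈ N, #(T v)) * Fintype.card α ^ Fintype.card V := by
  have h : ({f : V → α | ∀ v ∈ N, f v ∈ T v} : Finset (V → α)) =
      Fintype.piFinset fun v => if v ∈ N then T v else univ := by
    ext f
    simp only [mem_filter, mem_univ, true_and, Fintype.mem_piFinset]
    refine forall_congr' fun v => ?_
    split_ifs with hv <;> simp [hv]
  have h2 : ∀ v, #(if v ∈ N then T v else univ) = if v ∈ N then #(T v) else Fintype.card α := by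
    intro v
    split_ifs <;> simp
  have h3 : #(univ \ N) + #N = Fintype.card V := by
    rw [Finset.card_sdiff_add_card_eq_card (subset_univ _), card_univ]
  rw [h, Fintype.card_piFinset, Finset.prod_congr rfl fun v _ => h2 v, Finset.prod_ite]
  have h4 : ({x | x ∈ N} : Finset V) = N := by ext; simp
  have h5 : ({x | x ∉ N} : Finset V) = univ \ N := by ext; simp
  rw [h4, h5, Finset.prod_const, ← h3, pow_add]
  ring

/-- Markov's inequality for the number of selected elements. -/
theorem card_many_selected_le (T : Finset α) (hT : T.Nonempty) {d B : ℕ}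
    (hd : #T * d = Fintype.card α) (hB : 9 * Fintype.card V ≤ B * d) :
    9 * #{f : V → α | B < #{v | f v ∈ T}} ≤ Fintype.card (V → α) := by
  rcases Nat.eq_zero_or_pos (Fintype.card V) with h0 | h0
  · have hempty : ({f : V → α | B < #{v | f v ∈ T}} : Finset (V → α)) = ∅ := by
      ext f
      simp only [mem_filter, mem_univ, true_and, notMem_empty, iff_false, not_lt]
      have := Finset.card_le_univ ({v | f v ∈ T} : Finset V)
      omega
    simp [hempty]
  have h1 : ∀ v : V, d * #{f : V → α | f v ∈ T} = Fintype.card (V → α) := by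
    intro v
    have := card_filter_forall_mem_mul {v} fun _ : V => T
    simp only [mem_singleton, forall_eq, card_singleton, pow_one, prod_singleton] at this
    rw [← hd] at this
    have hp := hT.card_pos
    rw [Fintype.card_fun, ← hd]
    exact Nat.eq_of_mul_eq_mul_left hp (by linarith)
  have h2 : B * #{f : V → α | B < #{v | f v ∈ T}} ≤ ∑ f : V → α, #{v | f v ∈ T} := by
    rw [mul_comm, ← smul_eq_mul]
    refine (Finset.card_nsmul_le_sum _ _ _ fun f hf => (mem_filter.1 hf).2.le).trans ?_
    exact Finset.sum_le_sum_of_subset (Finset.filter_subset _ _)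
  have h3 : ∑ f : V → α, #{v | f v ∈ T} = ∑ v : V, #{f : V → α | f v ∈ T} :=
    Finset.sum_card_bipartiteAbove_eq_sum_card_bipartiteBelow fun (f : V → α) (v : V) => f v ∈ T
  have h4 : d * ∑ v : V, #{f : V → α | f v ∈ T} = Fintype.card V * Fintype.card (V → α) := by
    rw [Finset.mul_sum, Finset.sum_congr rfl fun v _ => h1 v]
    simp
  have h5 := Nat.mul_le_mul_left d h2
  rw [h3, h4] at h5
  refine Nat.le_of_mul_le_mul_left (le_trans ?_ h5) h0
  calc _ = 9 * Fintype.card V * #{f : V → α | B < #{v | f v ∈ T}} := by ring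
    _ ≤ B * d * #{f : V → α | B < #{v | f v ∈ T}} := Nat.mul_le_mul_right _ hB
    _ = _ := by ring

/-- Combines (1 - x)^N ≤ exp(-Nx) with 1 + Nx ≤ exp(Nx). -/
theorem one_sub_pow_mul_le {x : ℝ} (hx1 : x ≤ 1) {N : ℕ} {c : ℝ} (hc : c ≤ 1 + N * x) :
    (1 - x) ^ N * c ≤ 1 := by
  have h0 : (0 : ℝ) ≤ (1 - x) ^ N := pow_nonneg (by linarith) _
  have h1 : (1 - x) ^ N ≤ Real.exp (-(N * x)) := by
    rw [show -(N * x) = N * (-x) by ring, Real.exp_nat_mul]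
    exact pow_le_pow_left₀ (by linarith) (by linarith [Real.add_one_le_exp (-x)]) _
  have h2 : c ≤ Real.exp (N * x) := by linarith [Real.add_one_le_exp (N * x)]
  calc (1 - x) ^ N * c ≤ (1 - x) ^ N * Real.exp (N * x) := mul_le_mul_of_nonneg_left h2 h0
    _ ≤ Real.exp (-(N * x)) * Real.exp (N * x) := mul_le_mul_of_nonneg_right h1 (Real.exp_pos _).le
    _ = 1 := by rw [← Real.exp_add]; simp

/-- A large set of nodes takes all of the values in `T` with high probability. -/
theorem card_missed_value_le (T : Finset α) (N : Finset V)
    (hN : 9 * #T * Fintype.card α ≤ #N) :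
    9 * #{f : V → α | ∃ l ∈ T, ∀ v ∈ N, f v ≠ l} ≤ Fintype.card (V → α) := by
  rcases T.eq_empty_or_nonempty with rfl | ⟨a, ha⟩
  · simp
  have hα : 0 < Fintype.card α := Fintype.card_pos_iff.2 ⟨a⟩
  have hT : 0 < #T := card_pos.2 ⟨a, ha⟩
  have hm : (0 : ℝ) < Fintype.card α := by exact_mod_cast hα
  have h1 : ∀ l ∈ T, (#{f : V → α | ∀ v ∈ N, f v ≠ l} : ℝ) * (9 * #T) ≤
      Fintype.card (V → α) := by
    intro l _
    have := card_filter_forall_mem_mul N fun _ : V => univ.erase l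
    simp only [mem_erase, mem_univ, and_true, prod_const, card_erase_of_mem (mem_univ l),
      card_univ] at this
    have hR : (#{f : V → α | ∀ v ∈ N, f v ≠ l} : ℝ) * (Fintype.card α : ℝ) ^ #N =
        ((Fintype.card α : ℝ) - 1) ^ #N * Fintype.card (V → α) := by
      rw [Fintype.card_fun, ← Nat.cast_pred hα]
      exact_mod_cast this
    have hR' : (#{f : V → α | ∀ v ∈ N, f v ≠ l} : ℝ) =
        (1 - (Fintype.card α : ℝ)⁻¹) ^ #N * Fintype.card (V → α) := by
      have hsub : 1 - (Fintype.card α : ℝ)⁻¹ = ((Fintype.card α : ℝ) - 1) / Fintype.card α := by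
        field_simp
      rw [hsub, div_pow]
      field_simp
      linarith
    -- Each value is missed with probability at most 1/(9 * #T); a union bound over `T` then gives
    -- 1/9.
    have hb := one_sub_pow_mul_le (x := (Fintype.card α : ℝ)⁻¹) (N := #N) (c := 9 * #T)
      (inv_le_one_of_one_le₀ (by exact_mod_cast hα)) (by
        have : (9 * #T * Fintype.card α : ℝ) ≤ #N := by exact_mod_cast hN
        have : (9 * #T : ℝ) ≤ #N * (Fintype.card α : ℝ)⁻¹ := by
          rw [← div_eq_mul_inv, le_div_iff₀ hm]; exact this
        linarith)
    rw [hR']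
    calc _ = ((1 - (Fintype.card α : ℝ)⁻¹) ^ #N * (9 * #T)) * Fintype.card (V → α) := by ring
      _ ≤ 1 * Fintype.card (V → α) := mul_le_mul_of_nonneg_right hb (by positivity)
      _ = _ := one_mul _
  have h2 : ({f : V → α | ∃ l ∈ T, ∀ v ∈ N, f v ≠ l} : Finset (V → α)) ⊆
      T.biUnion fun l => {f : V → α | ∀ v ∈ N, f v ≠ l} := by
    intro f
    simp
  have h3 := (Finset.card_le_card h2).trans Finset.card_biUnion_le
  have h4 : ∀ l ∈ T, #{f : V → α | ∀ v ∈ N, f v ≠ l} * (9 * #T) ≤ Fintype.card (V → α) :=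
    fun l hl => by exact_mod_cast h1 l hl
  refine Nat.le_of_mul_le_mul_left ?_ hT
  calc #T * (9 * #{f : V → α | ∃ l ∈ T, ∀ v ∈ N, f v ≠ l})
      ≤ #T * (9 * ∑ l ∈ T, #{f : V → α | ∀ v ∈ N, f v ≠ l}) := by gcongr
    _ = ∑ l ∈ T, #{f : V → α | ∀ v ∈ N, f v ≠ l} * (9 * #T) := by rw [← Finset.sum_mul]; ring
    _ ≤ #T * Fintype.card (V → α) := by
      rw [← smul_eq_mul]; exact Finset.sum_le_card_nsmul _ _ _ h4

/-- With sufficiently many repetitions, the prescribed colours are assigned to given vertices in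
some repetition with high probability. -/
theorem card_never_coloured_le {m R : ℕ} (hm : 0 < m) (hR : 8 * m ^ m ≤ R) {z : ℕ → V}
    (hz : ∀ i < m, ∀ j < m, z i = z j → i = j) :
    9 * #{g : V → Fin R → Fin m | ¬ ∃ r, ∀ i < m, (g (z i) r : ℕ) = i} ≤
      Fintype.card (V → Fin R → Fin m) := by
  set good : Finset (V → Fin m) := {g | ∀ i < m, (g (z i) : ℕ) = i} with hgood
  have hc := card_filter_forall_mem_mul ((range m).image z)
    fun v : V => ({c : Fin m | z c = v} : Finset (Fin m))
  have hinj : Set.InjOn z (range m : Set ℕ) := fun i hi j hj h => by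
    simp only [coe_range, Set.mem_Iio] at hi hj
    exact hz i hi j hj h
  have hset : ({f : V → Fin m | ∀ v ∈ (range m).image z, f v ∈ ({c : Fin m | z c = v} :
      Finset (Fin m))} : Finset (V → Fin m)) = good := by
    ext f
    simp only [hgood, mem_filter, mem_univ, true_and, mem_image, mem_range,
      forall_exists_index, and_imp, forall_apply_eq_imp_iff₂]
    refine forall_congr' fun i => forall_congr' fun hi => ?_
    exact ⟨fun h => hz _ (f (z i)).2 i hi h, fun h => by rw [h]⟩
  have hone : ∀ v ∈ (range m).image z, #({c : Fin m | z c = v} : Finset (Fin m)) = 1 := by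
    intro v hv
    simp only [mem_image, mem_range] at hv
    obtain ⟨i, hi, rfl⟩ := hv
    rw [Finset.card_eq_one]
    refine ⟨⟨i, hi⟩, ?_⟩
    ext c
    simp only [mem_filter, mem_univ, true_and, mem_singleton, Fin.ext_iff]
    exact ⟨fun h => hz _ c.2 i hi h, fun h => by rw [h]⟩
  rw [hset, Finset.prod_congr rfl hone, Finset.card_image_of_injOn hinj, prod_const_one, one_mul,
    card_range, Fintype.card_fin] at hc
  -- Exchanging nodes and repetitions shows the repetitions to be independent: the bad outcomes are
  -- `R`-tuples of bad colourings.
  have hbad : #{g : V → Fin R → Fin m | ¬ ∃ r, ∀ i < m, (g (z i) r : ℕ) = i} =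
      #(univ \ good) ^ R := by
    have : #(Fintype.piFinset fun _ : Fin R => univ \ good) = #(univ \ good) ^ R := by simp
    rw [← this]
    refine Finset.card_equiv (Equiv.piComm _) fun g => ?_
    simp [hgood, Function.swap]
  have htot : Fintype.card (V → Fin R → Fin m) = (m ^ Fintype.card V) ^ R := by
    simp only [Fintype.card_fun, Fintype.card_fin]
    rw [← pow_mul, ← pow_mul, mul_comm]
  have hsd : #(univ \ good) + #good = m ^ Fintype.card V := by
    rw [Finset.card_sdiff_add_card_eq_card (subset_univ _), card_univ, Fintype.card_fun,
      Fintype.card_fin]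
  have hm' : (0 : ℝ) < m := by exact_mod_cast hm
  have hq : (#(univ \ good) : ℝ) = (1 - ((m : ℝ) ^ m)⁻¹) * m ^ Fintype.card V := by
    have h1 : (#good : ℝ) * (m : ℝ) ^ m = m ^ Fintype.card V := by exact_mod_cast hc
    have h2 : (#(univ \ good) : ℝ) + #good = m ^ Fintype.card V := by exact_mod_cast hsd
    have h3 : (#good : ℝ) = ((m : ℝ) ^ m)⁻¹ * m ^ Fintype.card V := by
      rw [← h1]; field_simp
    linarith
  have hb := one_sub_pow_mul_le (x := ((m : ℝ) ^ m)⁻¹) (N := R) (c := 9)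
    (inv_le_one_of_one_le₀ (one_le_pow₀ (by exact_mod_cast hm))) (by
      have : (8 : ℝ) * (m : ℝ) ^ m ≤ R := by exact_mod_cast hR
      have : (8 : ℝ) ≤ R * ((m : ℝ) ^ m)⁻¹ := by
        rw [← div_eq_mul_inv, le_div_iff₀ (by positivity)]; exact this
      linarith)
  rw [hbad, htot]
  have : (9 * (#(univ \ good) : ℝ) ^ R) ≤ ((m : ℝ) ^ Fintype.card V) ^ R := by
    rw [hq, mul_pow]
    have hp : (0 : ℝ) ≤ ((m : ℝ) ^ Fintype.card V) ^ R := by positivity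
    nlinarith
  exact_mod_cast this

/-- Two stages of independent choices: most of the outcomes of the first stage are such that most of
the outcomes of the second stage lead to the event `E`. -/
theorem two_thirds_le_uniform {β : Type*} [Fintype β] [Nonempty α] [Nonempty β]
    (E : Set (V → α × β)) (bad : Finset (V → α)) (hbad : 9 * #bad ≤ 2 * Fintype.card (V → α))
    (h : ∀ f ∉ bad, ∃ bad' : Finset (V → β), 9 * #bad' ≤ Fintype.card (V → β) ∧
      ∀ g ∉ bad', (fun v => (f v, g v)) ∈ E) :
    2 / 3 ≤ (PMF.uniformOfFintype (V → α × β)).toOuterMeasure E := by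
  classical
  rw [PMF.toOuterMeasure_uniformOfFintype_apply]
  have hprod : Fintype.card (V → α × β) = Fintype.card (V → α) * Fintype.card (V → β) := by
    simp [mul_pow]
  have hcard : #(univ \ bad) * (8 * Fintype.card (V → β)) ≤ 9 * Fintype.card E := by
    have hsec : ∀ f ∈ univ \ bad, 8 * Fintype.card (V → β) ≤
        9 * #{g : V → β | (fun v => (f v, g v)) ∈ E} := by
      intro f hf
      obtain ⟨bad', hb, hg⟩ := h f (by simpa using hf)
      have h1 : univ \ bad' ⊆ ({g : V → β | (fun v => (f v, g v)) ∈ E} : Finset _) := by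
        intro g hg'
        simp only [mem_sdiff, mem_univ, true_and] at hg'
        simpa using hg g hg'
      have h2 := Finset.card_le_card h1
      have h3 : #(univ \ bad') + #bad' = Fintype.card (V → β) :=
        Finset.card_sdiff_add_card_eq_card (subset_univ _)
      omega
    rw [← smul_eq_mul]
    refine (Finset.card_nsmul_le_sum _ _ _ hsec).trans ?_
    rw [← Finset.mul_sum, ← Finset.card_sigma, ← Set.toFinset_card]
    refine Nat.mul_le_mul_left 9 ?_
    refine Finset.card_le_card_of_injOn (fun p v => (p.1 v, p.2 v)) (fun p hp => ?_) ?_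
    · simp only [coe_sigma, Set.mem_sigma_iff, mem_coe, mem_filter] at hp
      simpa using hp.2.2
    · rintro ⟨f, g⟩ - ⟨f', g'⟩ - hfg
      have h1 : ∀ v, f v = f' v ∧ g v = g' v := fun v => Prod.mk.inj (congrFun hfg v)
      obtain rfl : f = f' := funext fun v => (h1 v).1
      obtain rfl : g = g' := funext fun v => (h1 v).2
      rfl
  have hsd : #(univ \ bad) + #bad = Fintype.card (V → α) :=
    Finset.card_sdiff_add_card_eq_card (subset_univ _)
  -- The two stages succeed with probability at least 7/9 · 8/9 = 56/81 ≥ 54/81.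
  have hfin : 2 * Fintype.card (V → α × β) ≤ 3 * Fintype.card E := by
    have h7 : 7 * Fintype.card (V → α) ≤ 9 * #(univ \ bad) := by omega
    have h8 := Nat.mul_le_mul_right (8 * Fintype.card (V → β)) h7
    rw [hprod]
    nlinarith [Nat.zero_le (Fintype.card (V → α) * Fintype.card (V → β))]
  have hpos : 0 < Fintype.card (V → α × β) := Fintype.card_pos
  rw [ENNReal.le_div_iff_mul_le (.inl (by exact_mod_cast hpos.ne'))
    (.inl (ENNReal.natCast_ne_top _)),
    ENNReal.div_eq_inv_mul, mul_assoc, ENNReal.inv_mul_le_iff (by simp) (by simp)]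
  exact_mod_cast hfin

end Counting
end Congest

/-! ### Choice of parameters and conclusion -/

namespace Congest
open Finset

theorem exists_nat_root {k : ℕ} (hk : k ≠ 0) {n : ℕ} (hn : 1 ≤ n) :
    ∃ d, 1 ≤ d ∧ d ^ k ≤ n ∧ n < (d + 1) ^ k := by
  have hex : ∃ d, n < (d + 1) ^ k := ⟨n, (Nat.lt_succ_self n).trans_le (Nat.le_self_pow hk _)⟩
  have h1 := Nat.find_spec hex
  have h2 : ∀ m < Nat.find hex, ¬ n < (m + 1) ^ k := fun m => Nat.find_min hex
  generalize Nat.find hex = d at h1 h2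
  have hd : 1 ≤ d := by
    by_contra h0
    obtain rfl : d = 0 := by omega
    simp at h1
    omega
  refine ⟨d, hd, ?_, h1⟩
  have := h2 (d - 1) (by omega)
  rw [Nat.sub_add_cancel hd] at this
  omega

theorem pow_pred_le_rpow {k d n : ℕ} (hk : 1 ≤ k) (h : d ^ k ≤ n) :
    (d : ℝ) ^ (k - 1) ≤ (n : ℝ) ^ (1 - 1 / (k : ℝ)) := by
  have hk' : (1 : ℝ) ≤ k := by exact_mod_cast hk
  have he : (0 : ℝ) ≤ 1 - 1 / (k : ℝ) := by
    rw [sub_nonneg, div_le_one (by linarith)]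
    exact hk'
  calc (d : ℝ) ^ (k - 1) = ((d : ℝ) ^ k) ^ (1 - 1 / (k : ℝ)) := by
        rw [← Real.rpow_natCast, ← Real.rpow_natCast, ← Real.rpow_mul (Nat.cast_nonneg _)]
        congr 1
        rw [Nat.cast_pred (by omega)]
        field_simp
    _ ≤ _ := Real.rpow_le_rpow (by positivity) (by exact_mod_cast h) he

/-- The probability that some node rejects after `T` rounds of the program `P`. -/
noncomputable def NodeProgram.rejectProb {b : ℕ} (P : NodeProgram b) (T : ℕ) {V : Type*} [Fintype V]
    [DecidableEq V] (G : SimpleGraph V) (ident : V → ℕ) : ENNReal :=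
  (PMF.uniformOfFintype (V → P.Seed)).toOuterMeasure
    {seed | ∃ v, P.rejects (stateAfter P G ident seed T v) = true}

theorem NodeProgram.rejectProb_eq_zero {b : ℕ} {P : NodeProgram b} {T : ℕ} {V : Type*} [Fintype V]
    [DecidableEq V] {G : SimpleGraph V} {ident : V → ℕ}
    (h : ∀ seed v, ¬ P.rejects (stateAfter P G ident seed T v) = true) :
    P.rejectProb T G ident = 0 := by
  have : {seed | ∃ v, P.rejects (stateAfter P G ident seed T v) = true} = ∅ :=
    Set.eq_empty_iff_forall_notMem.2 fun seed ⟨v, hv⟩ => h seed v hv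
  rw [NodeProgram.rejectProb, this]
  exact MeasureTheory.measure_empty

/-- In `T` rounds the program `P` detects the cycles of length `l` of all networks with `n` nodes and
identifiers below `n ^ c`. -/
def NodeProgram.DetectsCycles.{u} {b : ℕ} (P : NodeProgram b) (T n c l : ℕ) : Prop :=
  ∀ (V : Type u) [Fintype V] [DecidableEq V] (G : SimpleGraph V) (ident : V → ℕ),
    Fintype.card V = n → Function.Injective ident → (∀ v, ident v < n ^ c) →
      (HasCycleOfLength G l → 2 / 3 ≤ P.rejectProb T G ident) ∧
      (¬ HasCycleOfLength G l → P.rejectProb T G ident = 0)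

/-- A node draws one of 2k²·d values and is selected if the value is below 2k², so with probability
1/d. A node of degree above 9·(2k²)·(2k²·d) very likely sees each of the 2k² selecting values among
its neighbours, hence has 2k² distinct selected neighbours. In the bound for `τ` the first summand
serves the light search, the second is `k` times the Markov bound on the number of selected nodes;
the factor 2^k there comes from n < (d + 1)^k ≤ (2d)^k. A phase needs 6Rτ + 1 rounds: there are 6R
searches with at most `τ` items each, and the extra round keeps the phase length positive, with room
for the announcement in phase 0. -/
theorem detectsCycles_toNodeProgram.{u} {k n c d R τ b : ℕ} (hk : 2 ≤ k) (hd : 1 ≤ d)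
    (hnd : n < (d + 1) ^ k) (hR : 8 * (2 * k) ^ (2 * k) ≤ R)
    (hτ : (9 * (2 * k ^ 2) * (2 * k ^ 2 * d)) ^ (k - 1) + k * (9 * 2 ^ k * d ^ (k - 1)) ≤ τ)
    [Nonempty (Fin (2 * k ^ 2 * d))] [Nonempty (Fin (2 * k))]
    {enc : Option (Fin R × Fin 3 × Bool) × Fin (n ^ c + 1) → Message b}
    (henc : Function.Injective enc) :
    ((cycleProgram k R (n ^ c) (9 * (2 * k ^ 2) * (2 * k ^ 2 * d)) τ (Fin (2 * k ^ 2 * d))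
      (Fin R → Fin (2 * k)) (fun a => (a : ℕ) < 2 * k ^ 2) (fun g r => (g r : ℕ))).toNodeProgram enc
        (6 * R * τ + 1)).DetectsCycles.{u} ((6 * R * τ + 1) * (k + 1)) n c (2 * k) := by
  intro V _ _ G ident hV hid hlt
  have hid2 : Function.Injective fun v => Fin.ofNat (n ^ c + 1) (ident v) := by
    intro u v huv
    have := congrArg Fin.val huv
    simp only [Fin.val_ofNat] at this
    rw [Nat.mod_eq_of_lt (by have := hlt u; omega), Nat.mod_eq_of_lt (by have := hlt v; omega)]
      at this
    exact hid this
  set D := 9 * (2 * k ^ 2) * (2 * k ^ 2 * d) with hD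
  have hrej : ∀ (seed : V → Fin (2 * k ^ 2 * d) × (Fin R → Fin (2 * k))) (v : V),
      ((cycleProgram k R (n ^ c) D τ (Fin (2 * k ^ 2 * d)) (Fin R → Fin (2 * k))
        (fun a => (a : ℕ) < 2 * k ^ 2) (fun g r => (g r : ℕ))).toNodeProgram enc
        (6 * R * τ + 1)).rejects (stateAfter _ G ident seed ((6 * R * τ + 1) * (k + 1)) v) = true ↔
      DetectedAt G k R D τ (fun u => ((seed u).1 : ℕ) < 2 * k ^ 2)
        (fun u r => ((seed u).2 r : ℕ)) v := by
    intro seed v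
    exact (iff_of_eq (congrArg (· = true) (BroadcastProgram.rejects_stateAfter_toNodeProgram
      (L := 6 * R * τ + 1) henc hid (Nat.succ_pos _) (fun t v => card_say_cycleProgram_le t _)
      (k + 1) v))).trans (cycleProgram_rejects_iff hid2 hid v)
  constructor
  · intro hcyc
    obtain ⟨z, hz, hcase⟩ := exists_isCycleSeq_light_or_heavy hcyc hk D
    have hk2 : 0 < k ^ 2 := pow_pos (by omega) 2
    have hmd : 0 < 2 * k ^ 2 * d := Nat.mul_pos (by omega) hd
    let T : Finset (Fin (2 * k ^ 2 * d)) := {a | (a : ℕ) < 2 * k ^ 2}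
    have hT : #T = 2 * k ^ 2 := by
      have : T.map Fin.valEmbedding = range (2 * k ^ 2) := by
        ext i
        simp only [T, mem_map, mem_filter, mem_univ, true_and, Fin.valEmbedding_apply, mem_range]
        refine ⟨fun ⟨a, ha, h⟩ => h ▸ ha, fun hi => ⟨⟨i, ?_⟩, hi, rfl⟩⟩
        exact hi.trans_le (Nat.le_mul_of_pos_right _ hd)
      rw [← Finset.card_map Fin.valEmbedding, this, card_range]
    have hTne : T.Nonempty := card_pos.1 (by omega)
    have hsel : ∀ a, a ∈ T ↔ (a : ℕ) < 2 * k ^ 2 := fun a => by simp [T]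
    set S := 9 * 2 ^ k * d ^ (k - 1) with hS
    have hSd : 9 * Fintype.card V ≤ S * d := by
      have h1 : S * d = 9 * (2 * d) ^ k := by
        rw [hS, mul_assoc, ← pow_succ, Nat.sub_add_cancel (by omega), mul_pow, mul_assoc]
      have h2 : (d + 1) ^ k ≤ (2 * d) ^ k := Nat.pow_le_pow_left (by omega) k
      rw [h1, hV]
      omega
    classical
    let N : Finset V := (G.neighborSet (z 0)).toFinset
    have hN : #N = (G.neighborSet (z 0)).ncard := (Set.ncard_eq_toFinset_card' _).symm
    have hrich : ∀ f : V → Fin (2 * k ^ 2 * d), (∀ l ∈ T, ∃ v ∈ N, f v = l) →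
        IsRich G k (fun u => (f u : ℕ) < 2 * k ^ 2) (z 0) := by
      intro f hf
      have hsub : T ⊆ (({s | (f s : ℕ) < 2 * k ^ 2 ∧ G.Adj s (z 0)} : Finset V)).image f := by
        intro l hl
        obtain ⟨v, hv, rfl⟩ := hf l hl
        rw [hsel] at hl
        simp only [N, Set.mem_toFinset, SimpleGraph.mem_neighborSet] at hv
        exact mem_image.2 ⟨v, by simp [hl, hv.symm], rfl⟩
      have := (card_le_card hsub).trans card_image_le
      rw [hT] at this
      rw [IsRich, Set.ncard_eq_toFinset_card']
      refine this.trans_eq ?_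
      congr 1
      ext s
      simp
    -- When the first vertex is not heavy, the cycle is light and no selected neighbours are needed,
    -- so nothing is excluded.
    let few : Finset (V → Fin (2 * k ^ 2 * d)) :=
      if D < (G.neighborSet (z 0)).ncard then
        ({f | ∃ l ∈ T, ∀ v ∈ N, f v ≠ l} : Finset (V → Fin (2 * k ^ 2 * d))) else ∅
    have hfew : 9 * #few ≤ Fintype.card (V → Fin (2 * k ^ 2 * d)) := by
      simp only [few]
      split_ifs with h
      · have hle := card_missed_value_le T N (by
          rw [hT, Fintype.card_fin, hN]
          exact h.le)
        convert hle
      · simp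
    have hmany := card_many_selected_le (V := V) T hTne (d := d) (B := S)
      (by rw [hT, Fintype.card_fin]) hSd
    refine two_thirds_le_uniform _ (few ∪
      ({f | S < #{v | f v ∈ T}} : Finset (V → Fin (2 * k ^ 2 * d)))) ?_ fun f hf => ?_
    · have := Finset.card_union_le few {f : V → Fin (2 * k ^ 2 * d) | S < #{v | f v ∈ T}}
      omega
    · simp only [mem_union, not_or, mem_filter, mem_univ, true_and, not_lt] at hf
      obtain ⟨hf1, hf2⟩ := hf
      have hselcard : {v | (f v : ℕ) < 2 * k ^ 2}.ncard ≤ S := by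
        rw [Set.ncard_eq_toFinset_card']
        refine le_trans (le_of_eq ?_) hf2
        congr 1
        ext v
        simp [hsel]
      have hD1 : 1 ≤ D := Nat.mul_pos (by omega) hmd
      have hDτ : D ^ (k - 1) ≤ τ := by omega
      -- The cycle to be detected depends on the selection `f` but not on the colours, so the
      -- colouring bound applies to it in the second stage.
      obtain ⟨z', hz', hdet⟩ := exists_isCycleSeq_detected (R := R)
        (sel := fun u => (f u : ℕ) < 2 * k ^ 2) hk ((Nat.one_le_pow _ _ hD1).trans hDτ) hD1 hDτ
        ((Nat.mul_le_mul_left k hselcard).trans (by omega)) hz (hcase.imp_right fun hh => by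
          simp only [few, if_pos hh, mem_filter, mem_univ, true_and] at hf1
          push Not at hf1
          exact hrich f hf1)
      refine ⟨_, card_never_coloured_le (by omega) hR hz'.inj, fun g hg => ?_⟩
      simp only [mem_filter, mem_univ, true_and, not_not] at hg
      obtain ⟨r, hr⟩ := hg
      obtain ⟨v, hv⟩ := hdet (fun u r => (g u r : ℕ)) r hr
      exact ⟨v, (hrej (fun v => (f v, g v)) v).2 hv⟩
  · intro hcyc
    exact NodeProgram.rejectProb_eq_zero fun seed v hv =>
      hcyc (((hrej seed v).1 hv).hasCycleOfLength hk)

/-- An item names a search and an identifier and must fit into one message; `n ≥ 2` makes the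
logarithm positive. -/
theorem card_item_le {R n c : ℕ} (hn : 2 ≤ n) :
    Fintype.card (Option (Fin R × Fin 3 × Bool) × Fin (n ^ c + 1)) ≤
      Fintype.card (Message ((2 * c + 1 + (6 * R + 1)) * Nat.log 2 n)) := by
  have hl : 1 ≤ Nat.log 2 n := Nat.log_pos (by norm_num) hn
  have h1 : n ^ c + 1 ≤ 2 ^ ((2 * c + 1) * Nat.log 2 n) := by
    have h2 : n ≤ 2 ^ (2 * Nat.log 2 n) :=
      (Nat.lt_pow_succ_log_self (by norm_num) n).le.trans
        (Nat.pow_le_pow_right (by norm_num) (by omega))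
    calc n ^ c + 1 ≤ (2 ^ (2 * Nat.log 2 n)) ^ c + (2 ^ (2 * Nat.log 2 n)) ^ c :=
          Nat.add_le_add (Nat.pow_le_pow_left h2 c) (Nat.one_le_pow _ _ (by positivity))
      _ = 2 ^ (2 * Nat.log 2 n * c + 1) := by rw [← pow_mul, pow_succ]; ring
      _ ≤ _ := Nat.pow_le_pow_right (by norm_num) (by nlinarith)
  have h3 : 6 * R + 1 ≤ 2 ^ ((6 * R + 1) * Nat.log 2 n) :=
    (Nat.lt_two_pow_self).le.trans
      (Nat.pow_le_pow_right (by norm_num) (Nat.le_mul_of_pos_right _ hl))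
  have h4 : Fintype.card (Option (Fin R × Fin 3 × Bool) × Fin (n ^ c + 1)) =
      (6 * R + 1) * (n ^ c + 1) := by
    simp only [Fintype.card_prod, Fintype.card_option, Fintype.card_fin, Fintype.card_bool]
    ring
  rw [h4, Fintype.card_fun, Fintype.card_bool, Fintype.card_fin, add_mul (2 * c + 1), pow_add,
    mul_comm]
  exact Nat.mul_le_mul h1 h3

theorem exists_detectsCycles.{u} {k : ℕ} (hk : 2 ≤ k) : ∃ C : ℝ, ∀ c, ∃ B : ℕ, ∀ n,
    ∃ (P : NodeProgram (B * Nat.log 2 n)) (T : ℕ), (T : ℝ) ≤ C * (n : ℝ) ^ (1 - 1 / (k : ℝ)) ∧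
      P.DetectsCycles.{u} T n c (2 * k) := by
  let R := 8 * (2 * k) ^ (2 * k)
  let τ₀ := (9 * (2 * k ^ 2) * (2 * k ^ 2)) ^ (k - 1) + k * (9 * 2 ^ k)
  let C := (6 * R * τ₀ + 1) * (k + 1)
  refine ⟨(C : ℕ), fun c => ⟨2 * c + 1 + (6 * R + 1), fun n => ?_⟩⟩
  -- For `n < 2` messages are empty, but there is no cycle either, so accepting without
  -- communication is correct.
  rcases Nat.lt_or_ge n 2 with hn | hn
  · refine ⟨⟨Unit, Unit, fun _ _ _ => (), fun _ _ => none, fun _ _ => (), fun _ => false⟩, 0,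
      by simp only [Nat.cast_zero]; positivity, ?_⟩
    intro V _ _ G ident hV _ _
    refine ⟨fun h => ?_, fun _ => ?_⟩
    · have := h.le_card
      omega
    · exact NodeProgram.rejectProb_eq_zero fun _ _ h => Bool.false_ne_true h
  · obtain ⟨d, hd, hdn, hnd⟩ := exists_nat_root (k := k) (by omega) (show 1 ≤ n by omega)
    have hne : Nonempty (Fin (2 * k ^ 2 * d)) :=
      Fin.pos_iff_nonempty.1 (Nat.mul_pos (Nat.mul_pos two_pos (pow_pos (by omega) 2)) hd)
    have hne' : Nonempty (Fin (2 * k)) := Fin.pos_iff_nonempty.1 (by omega)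
    obtain ⟨enc⟩ := Function.Embedding.nonempty_of_card_le (card_item_le (R := R) (c := c) hn)
    refine ⟨_, _, ?_, detectsCycles_toNodeProgram (τ := τ₀ * d ^ (k - 1)) hk hd hnd le_rfl
      (le_of_eq ?_) enc.injective⟩
    · have hd1 : 1 ≤ d ^ (k - 1) := Nat.one_le_pow _ _ hd
      have h1 : (6 * R * (τ₀ * d ^ (k - 1)) + 1) * (k + 1) ≤ C * d ^ (k - 1) := by
        calc _ ≤ (6 * R * (τ₀ * d ^ (k - 1)) + d ^ (k - 1)) * (k + 1) := by gcongr
          _ = _ := by simp only [C]; ring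
      calc _ ≤ (C : ℝ) * (d : ℝ) ^ (k - 1) := by exact_mod_cast h1
        _ ≤ _ := mul_le_mul_of_nonneg_left (pow_pred_le_rpow (by omega) hdn) (Nat.cast_nonneg _)
    · simp only [τ₀, add_mul]
      rw [← mul_assoc, mul_pow]
      ring

end Congest

theorem theorem5 (k : ℕ) (hk : k = 3 ∨ k = 4 ∨ k = 5) :
    ∃ C : ℝ, ∀ c : ℕ, ∃ A : Congest.Algorithm,
      (∀ n : ℕ, (A.rounds n : ℝ) ≤ C * (n : ℝ) ^ (1 - 1 / (k : ℝ))) ∧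
      ∀ (V : Type*) [Fintype V] [DecidableEq V] (G : SimpleGraph V) (ident : V → ℕ),
        Function.Injective ident → (∀ v, ident v < Fintype.card V ^ c) →
          (Congest.HasCycleOfLength G (2 * k) → 2 / 3 ≤ A.rejectProb G ident) ∧
          (¬ Congest.HasCycleOfLength G (2 * k) → A.rejectProb G ident = 0) := by
  obtain ⟨C, hC⟩ := Congest.exists_detectsCycles (k := k) (by omega)
  refine ⟨C, fun c => ?_⟩
  obtain ⟨B, hB⟩ := hC c
  choose P T hT hP using hB
  exact ⟨⟨B, T, P⟩, hT, fun V _ _ G ident hid hlt => hP (Fintype.card V) V G ident rfl hid hlt⟩
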